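/- Let $d\ge 2$, $n\ge 2$ and $0<a_1<\dots<a_n$. Put $v_n(x_1,x_2)=\mathrm{Re}\big(-\prod_{i=1}^n(z^2-a_i^2)\big)$ with $z=x_1+ix_2$, and for $\varepsilon>0$ and $x\in\mathbb R^d$ $$u_\varepsilon(x)=\frac{1}{2(d-1)}\big(1-x_2^2-\dots-x_d^2\big)+\varepsilon\, v_n(x_1,x_2).$$ Let $\Omega_\varepsilon$ be the connected component of $\{x\in\mathbb R^d: u_\varepsilon(x)>0\}$ containing $0$. For $\Omega\subset\mathbb R^d$ let $\mathrm{Star}(\Omega)$ be the set of points $x\in\Omega$ with respect to which $\Omega$ is star-shaped, and let $B^{d-1}(0,r)$ be the open ball of radius $r$ about $0$ in $\mathbb R^{d-1}$. There are $\varepsilon_0>0$ and constants $C,c>0$, depending only on $d$, $n$ and the $a_i$, such that for every $0<\varepsilon<\varepsilon_0$ the set $\Omega_\varepsilon$ is a bounded domain with $C^\infty$ boundary and the following hold. (i) $u_\varepsilon$ is the unique solution in $C^2(\Omega_\varepsilon)\cap C^0(\overline{\Omega_\varepsilon})$ of $-\Delta u=1$ in $\Omega_\varepsilon$, $u=0$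 on $\partial\Omega_\varepsilon$; one has $\|u_\varepsilon\|_{C^l(\Omega_\varepsilon)}=\sum_{k\le l}\sup_{\Omega_\varepsilon}|D^ku_\varepsilon|\le C$ for all $l\ge 0$; and $\Omega_\varepsilon\subset(-D\varepsilon^{-1/(2n)},D\varepsilon^{-1/(2n)})\times B^{d-1}(0,\sqrt2)$ with $D=\big(\tfrac1{d-1}\big)^{1/(2n)}$. (ii) $\Omega_\varepsilon$ is star-shaped with respect to the origin. (iii) The set $\{x\in\Omega_\varepsilon: u_\varepsilon(x)>\frac1{2(d-1)}\}$ has exactly $n$ connected components, and on each of them $u_\varepsilon$ attains a maximum, with value greater than $\frac1{2(d-1)}+c\,\varepsilon$. (iv) In $\Omega_\varepsilon$, $u_\varepsilon$ has exactly $n$ local maximum points and exactly $n-1$ saddle points (critical points that are neither local maxima nor local minima). It has no other critical points in $\Omega_\varepsilon$, and all its critical points there are nondegenerate, i.e. the Hessian matrix is invertible. Moreover: (v) the Lebesgue measure of $\Omega_\varepsilon\setminus\mathrm{Star}(\Omega_\varepsilon)$ tends to $0$ as $\varepsilon\to0^+$; (vi) $\Omega_\varepsilon$ converges locally to the cylinder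 $F=\{x\in\mathbb R^d:(x_2,\dots,x_d)\in B^{d-1}(0,1)\}$: for every compact $Q\subset\mathbb R^d$ and every $\delta>0$, the symmetric difference of $\Omega_\varepsilon\cap Q$ and $F\cap Q$ is contained in the $\delta$-neighbourhood of $\partial F$ for all sufficiently small $\varepsilon>0$, and its Lebesgue measure tends to $0$ as $\varepsilon\to0^+$. -/

import Mathlib

open Set Filter Topology MeasureTheory
open scoped ContDiff ENNReal

noncomputable section

namespace Torsion

/-- The holomorphic polynomial `F(z) = -∏ (z - a_i) (z + a_i)`. -/
def holF {n : ℕ} (a : Fin n → ℝ) (z : ℂ) : ℂ :=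
  -∏ i, ((z - (a i : ℂ)) * (z + (a i : ℂ)))

/-- The harmonic function `v_n(s, t) = Re F(s + i t)` on the plane. -/
def v {n : ℕ} (a : Fin n → ℝ) (s t : ℝ) : ℝ :=
  (holF a ((s : ℂ) + (t : ℂ) * Complex.I)).re

/-- The index of the first coordinate `x₁` of `ℝ^d`. -/
def i₁ {d : ℕ} (hd : 2 ≤ d) : Fin d := ⟨0, by omega⟩

/-- The index of the second coordinate `x₂` of `ℝ^d`. -/
def i₂ {d : ℕ} (hd : 2 ≤ d) : Fin d := ⟨1, by omega⟩

/-- `x₂² + ⋯ + x_d²`. -/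
def crossSq {d : ℕ} (hd : 2 ≤ d) (x : EuclideanSpace ℝ (Fin d)) : ℝ :=
  ∑ i ∈ Finset.univ.erase (i₁ hd), x i ^ 2

/-- The function
`u_ε(x) = (1 - x₂² - ⋯ - x_d²) / (2 (d - 1)) + ε v_n(x₁, x₂)` on `ℝ^d`. -/
def u {d n : ℕ} (hd : 2 ≤ d) (a : Fin n → ℝ) (ε : ℝ) (x : EuclideanSpace ℝ (Fin d)) : ℝ :=
  1 / (2 * ((d : ℝ) - 1)) * (1 - crossSq hd x) + ε * v a (x (i₁ hd)) (x (i₂ hd))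

/-- `Ω_ε`: the connected component of `{u_ε > 0}` that contains the origin. -/
def Om {d n : ℕ} (hd : 2 ≤ d) (a : Fin n → ℝ) (ε : ℝ) : Set (EuclideanSpace ℝ (Fin d)) :=
  connectedComponentIn {x | 0 < u hd a ε x} 0

/-- The cylinder `ℝ × B^{d-1}(0, r)`, for `r > 0`. -/
def cylinder {d : ℕ} (hd : 2 ≤ d) (r : ℝ) : Set (EuclideanSpace ℝ (Fin d)) :=
  {x | crossSq hd x < r ^ 2}

/-- A bounded domain (nonempty connected open set) with `C^∞` boundary: near each of its boundary
points the set is `{ρ > 0}` for a smooth local defining function `ρ` without critical points. -/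
structure IsSmoothBoundedDomain {d : ℕ} (Ω : Set (EuclideanSpace ℝ (Fin d))) : Prop where
  isOpen : IsOpen Ω
  isConnected : IsConnected Ω
  isBounded : Bornology.IsBounded Ω
  smooth_boundary : ∀ p ∈ frontier Ω, ∃ U : Set (EuclideanSpace ℝ (Fin d)), IsOpen U ∧ p ∈ U ∧
    ∃ ρ : EuclideanSpace ℝ (Fin d) → ℝ, ContDiffOn ℝ ∞ ρ U ∧
      (∀ x ∈ U, fderiv ℝ ρ x ≠ 0) ∧ Ω ∩ U = {x ∈ U | 0 < ρ x}

/-- `w` is a classical solution, in `C²(Ω) ∩ C⁰(closure Ω)`, of the torsion problem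
`-Δ w = 1` in `Ω`, `w = 0` on `∂Ω`. -/
structure IsTorsionSolution {d : ℕ} (Ω : Set (EuclideanSpace ℝ (Fin d)))
    (w : EuclideanSpace ℝ (Fin d) → ℝ) : Prop where
  contDiffOn : ContDiffOn ℝ 2 w Ω
  continuousOn : ContinuousOn w (closure Ω)
  equation : ∀ x ∈ Ω, -(Laplacian.laplacian w x) = 1
  boundary : ∀ x ∈ frontier Ω, w x = 0

/-- The `C^l(Ω)` norm, `∑_{k ≤ l} sup_Ω |D^k w|`, of a smooth function on an open set `Ω`. -/
def cNorm {d : ℕ} (l : ℕ) (Ω : Set (EuclideanSpace ℝ (Fin d)))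
    (w : EuclideanSpace ℝ (Fin d) → ℝ) : ℝ≥0∞ :=
  ∑ k ∈ Finset.range (l + 1), ⨆ x ∈ Ω, ‖iteratedFDeriv ℝ k w x‖ₑ

/-- `Star(Ω)`: the points of `Ω` with respect to which `Ω` is star-shaped. -/
def starSet {d : ℕ} (Ω : Set (EuclideanSpace ℝ (Fin d))) : Set (EuclideanSpace ℝ (Fin d)) :=
  {x ∈ Ω | StarConvex ℝ x Ω}

/-- The set of connected components of the set `S`. -/
def components {d : ℕ} (S : Set (EuclideanSpace ℝ (Fin d))) :
    Set (Set (EuclideanSpace ℝ (Fin d))) :=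
  {K | ∃ x ∈ S, K = connectedComponentIn S x}

/-- The Hessian matrix `(∂_i ∂_j w)(x)`. -/
def hessian {d : ℕ} (w : EuclideanSpace ℝ (Fin d) → ℝ) (x : EuclideanSpace ℝ (Fin d)) :
    Matrix (Fin d) (Fin d) ℝ :=
  Matrix.of fun i j =>
    iteratedFDeriv ℝ 2 w x ![EuclideanSpace.single i 1, EuclideanSpace.single j 1]

/-- A saddle point: a critical point that is neither a local maximum nor a local minimum. -/
def IsSaddlePoint {d : ℕ} (w : EuclideanSpace ℝ (Fin d) → ℝ)
    (x : EuclideanSpace ℝ (Fin d)) : Prop :=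
  fderiv ℝ w x = 0 ∧ ¬ IsLocalMax w x ∧ ¬ IsLocalMin w x

end Torsion

end

/-!
Write `A = 1 / (2 (d - 1))`, let `Y x = (0, x₂, …, x_d)` (`crossProj`), `Z x = x₁ + i x₂`
(`planeMap`), and let `f` be the real polynomial `-∏ (X² - a_i²)`. Then
`u_ε(x) = A (1 - |Y x|²) + ε Re f(Z x)`, and `Δ u_ε = -1` because `Re f` is harmonic. The roots
`± a_i` are listed increasingly as `r 0 < ⋯ < r (2 n - 1)` (`exists_strictMono_nodes`), and `f` is
treated as `nodePoly (2 n) r`; the symmetry of the roots is not needed.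

On the strip `|Im z| ≤ 2` the polynomial and its first two derivatives behave like those of
`-(Re z)^(2 n)` for `|Re z| ≥ M`, and they are bounded for `|Re z| ≤ M` (`StripBounds`). Let
`L = (1 / (d - 1))^(1 / (2 n)) ε^(-1 / (2 n))`, so that `ε L^(2 n) = 2 A`. Then `u_ε < 0` where
`|Y x|² = 2`, and where `|Y x|² ≤ 2` and `|x₁| ≥ L`. The heart of the matter is
`dTorsionFn_sub_neg`: if `u_ε(x₀) > 0` and `|Y x₀| ≤ 1 - ρ`, with `ρ` a multiple of `ε L`, the
derivative of `u_ε` in the direction `x - x₀` is negative at every `x` with `u_ε(x) ≤ 0`. For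
`|x₁| ≤ M` the quadratic part dominates. For `|x₁| ≥ M` the function `u_ε` is concave in the end of
the slab containing `x`, since `ε |f''| ≤ A` there, and the tangent inequality is applied to `x₀`
or, when `x₀` is not in this end, to its translate along the axis to `|x₁| = M`; the translation only
helps, as `x₁ Re f'(Z x) < 0`. Consequently `u_ε` cannot return to positive values along a segment
from `x₀` once it is nonpositive, and so the part of `{u_ε > 0}` in the slab `|Y x|² < 2` is
star-shaped with respect to each such `x₀`. For `x₀ = 0` this shows that this part is the component
`Ω_ε` (`connectedComponentIn_eq_posSet`), and that the gradient of `u_ε` does not vanish on its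
boundary. For general `x₀` it shows that `Ω_ε \ Star(Ω_ε)` lies in a shell `||Y x| - 1| ≤ ρ` of
length `2 L`, whose volume is `O(L ρ) = O(L^(2 - 2 n))`; here `n ≥ 2` is used.

For `|x₁| ≤ M` the function `u_ε` strictly decreases when one leaves the axis orthogonally, because
`|Im f'(z)| = O(|Im z|)` (`strictAntiOn_torsionFn`). So the critical points lie on the axis, where
`u_ε = A + ε f`, and the components of `{u_ε > A}` retract to the intervals on which `f > 0`. As `f`
has `2 n` simple real roots, it has exactly one critical point in each of the `2 n - 1` gaps between
them, all nondegenerate and alternately maxima and minima of `f` (`exists_critical_points`). The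
maxima of `f` are the local maxima of `u_ε`, its minima the saddle points. Uniqueness is the weak
maximum principle (`nonpos_of_laplacian_nonneg`), and the `C^l` bounds hold since the derivatives of
`ε Re f(Z x)` are `O(ε L^(2 n))` and vanish from order `2 n + 1` on (`PolyControl`).
-/

namespace Torsion

open Polynomial

/-! ### Polynomials with simple real roots -/

/-- The real polynomial `-∏_{k < m} (X - r k)` with prescribed simple roots. -/
noncomputable def nodePoly (m : ℕ) (r : ℕ → ℝ) : ℝ[X] :=
  -∏ k ∈ Finset.range m, (X - C (r k))

lemma eval_nodePoly (m : ℕ) (r : ℕ → ℝ) (s : ℝ) :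
    (nodePoly m r).eval s = -∏ k ∈ Finset.range m, (s - r k) := by
  simp [nodePoly, Polynomial.eval_prod]

lemma aeval_nodePoly (m : ℕ) (r : ℕ → ℝ) (z : ℂ) :
    Polynomial.aeval z (nodePoly m r) = -∏ k ∈ Finset.range m, (z - r k) := by
  simp [nodePoly, map_prod]

lemma natDegree_nodePoly (m : ℕ) (r : ℕ → ℝ) : (nodePoly m r).natDegree = m := by
  rw [nodePoly, Polynomial.natDegree_neg, Polynomial.natDegree_finsetProd_X_sub_C_eq_card]
  simp

lemma leadingCoeff_nodePoly (m : ℕ) (r : ℕ → ℝ) : (nodePoly m r).leadingCoeff = -1 := by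
  rw [nodePoly, Polynomial.leadingCoeff_neg, Polynomial.leadingCoeff_prod]
  simp

/-- The roots `±a_i` of `holF a`, listed in increasing order, give `holF` as a `nodePoly`. -/
lemma exists_strictMono_nodes {n : ℕ} (a : Fin n → ℝ) (ha_pos : ∀ i, 0 < a i)
    (ha_mono : StrictMono a) :
    ∃ r : ℕ → ℝ, StrictMono r ∧
      ∀ z : ℂ, holF a z = Polynomial.aeval z (nodePoly (2 * n) r) := by
  -- `b` extends `a` to a strictly increasing sequence
  obtain ⟨b, hb, hbpos, hba⟩ : ∃ b : ℕ → ℝ, StrictMono b ∧ (∀ k, 0 < b k) ∧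
      ∀ i : Fin n, b i = a i := by
    rcases Nat.eq_zero_or_pos n with rfl | hn
    · exact ⟨fun k => (k : ℝ) + 1, fun i j h => by simpa using h, fun k => by positivity,
        fun i => i.elim0⟩
    · refine ⟨fun k => if h : k < n then a ⟨k, h⟩ else a ⟨n - 1, by omega⟩ + k,
        strictMono_nat_of_lt_succ fun k => ?_, fun k => ?_, fun i => by simp⟩
      · by_cases h1 : k + 1 < n
        · rw [dif_pos h1, dif_pos (by omega)]
          exact ha_mono (by simp)
        · rw [dif_neg h1]
          by_cases h2 : k < n
          · rw [dif_pos h2]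
            have : a ⟨k, h2⟩ ≤ a ⟨n - 1, by omega⟩ := ha_mono.monotone (by
              rw [Fin.mk_le_mk]; omega)
            have : (0 : ℝ) < (k + 1 : ℕ) := by positivity
            linarith
          · rw [dif_neg h2]
            push_cast
            linarith
      · dsimp only
        split_ifs
        · exact ha_pos _
        · have := ha_pos ⟨n - 1, by omega⟩
          positivity
  refine ⟨fun k => if k < n then -b (n - 1 - k) else b (k - n),
    strictMono_nat_of_lt_succ fun k => ?_, fun z => ?_⟩
  · by_cases h1 : k + 1 < n
    · rw [if_pos h1, if_pos (by omega)]
      exact neg_lt_neg (hb (by omega))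
    · rw [if_neg h1]
      split_ifs with h2
      · linarith [hbpos (n - 1 - k), hbpos (k + 1 - n)]
      · exact hb (by omega)
  · rw [aeval_nodePoly, holF, Finset.prod_mul_distrib, two_mul, Finset.prod_range_add, mul_comm]
    congr 2
    · rw [← Finset.prod_range_reflect, Finset.prod_range]
      refine Finset.prod_congr rfl fun i _ => ?_
      have h : n - 1 - (i : ℕ) < n := by have := i.2; omega
      have h' : n - 1 - (n - 1 - (i : ℕ)) = i := by have := i.2; omega
      rw [if_pos h, h', hba]
      simp
    · rw [Finset.prod_range]
      refine Finset.prod_congr rfl fun i _ => ?_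
      rw [if_neg (by omega), Nat.add_sub_cancel_left, hba]

/-- If exactly the first `c` of `m` nodes lie to the left of `s`, the sign of `∏ (s - r k)` is
`(-1) ^ (m - c)`. -/
lemma sign_prod_nodes {r : ℕ → ℝ} {m c : ℕ} (hc : c ≤ m) {s : ℝ} (h1 : ∀ k < c, r k < s)
    (h2 : ∀ k, c ≤ k → k < m → s < r k) :
    0 < (-1) ^ (m - c) * ∏ k ∈ Finset.range m, (s - r k) := by
  rw [← Finset.prod_range_mul_prod_Ico _ hc, mul_left_comm]
  refine mul_pos (Finset.prod_pos fun k hk => sub_pos.2 (h1 k (Finset.mem_range.1 hk))) ?_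
  have : (-1 : ℝ) ^ (m - c) * ∏ k ∈ Finset.Ico c m, (s - r k)
      = ∏ k ∈ Finset.Ico c m, (r k - s) := by
    rw [← Nat.card_Ico, ← Finset.prod_const, ← Finset.prod_mul_distrib]
    exact Finset.prod_congr rfl fun k _ => by ring
  rw [this]
  refine Finset.prod_pos fun k hk => sub_pos.2 ?_
  rw [Finset.mem_Ico] at hk
  exact h2 k hk.1 hk.2

/-- Between consecutive nodes the sign alternates. -/
lemma sign_nodePoly_gap {r : ℕ → ℝ} (hr : StrictMono r) {n : ℕ} {k : ℕ}
    (hk : k + 1 < 2 * n) {s : ℝ} (h1 : r k < s) (h2 : s < r (k + 1)) : 0 < (-1) ^ k * (nodePoly (2 * n) r).eval s := by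
  have h := sign_prod_nodes (m := 2 * n) (c := k + 1) (s := s) hk.le
    (fun j hj => (hr.monotone (Nat.lt_succ_iff.1 hj)).trans_lt h1)
    (fun j hj _ => h2.trans_le (hr.monotone hj))
  rw [eval_nodePoly]
  rcases Nat.even_or_odd k with he | ho
  · rw [Odd.neg_one_pow (by grind)] at h
    rw [he.neg_one_pow]; linarith
  · rw [Even.neg_one_pow (by grind)] at h
    rw [ho.neg_one_pow]; linarith

lemma exists_gap_of_eval_pos {r : ℕ → ℝ} (hr : StrictMono r) {n : ℕ} {s : ℝ}
    (hs : 0 < (nodePoly (2 * n) r).eval s) :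
    ∃ j < n, r (2 * j) < s ∧ s < r (2 * j + 1) := by
  classical
  have hex : ∃ k, s ≤ r k ∨ k = 2 * n := ⟨2 * n, Or.inr rfl⟩
  set c := Nat.find hex with hcdef
  have hc : c ≤ 2 * n := Nat.find_min' hex (Or.inr rfl)
  have h1 : ∀ k < c, r k < s := fun k hk => by
    have := Nat.find_min hex hk
    push Not at this
    exact this.1
  have h2 : ∀ k, c ≤ k → k < 2 * n → s < r k := by
    intro k hk hkn
    have hcs : s ≤ r c := by
      rcases Nat.find_spec hex with h | h
      · exact h
      · omega
    refine (hcs.lt_of_ne fun h => ?_).trans_le (hr.monotone hk)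
    rw [eval_nodePoly, Finset.prod_eq_zero (i := c) (Finset.mem_range.2 (by omega))
      (sub_eq_zero.2 h)] at hs
    simp at hs
  have h := sign_prod_nodes hc h1 h2
  rw [eval_nodePoly] at hs
  rcases Nat.even_or_odd c with he | ho
  · rw [Even.neg_one_pow (by grind)] at h
    linarith
  · obtain ⟨j, hj⟩ := ho
    exact ⟨j, by omega, h1 _ (by omega), hj ▸ h2 _ le_rfl (by omega)⟩

/-- `c` lists the critical points of `nodePoly (2 * n) r`: one in each of the `2 n - 1` gaps between
consecutive nodes, all of them nondegenerate. -/
structure IsCriticalSeq (n : ℕ) (r c : ℕ → ℝ) : Prop where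
  lt : ∀ k, k + 1 < 2 * n → r k < c k
  lt_succ : ∀ k, k + 1 < 2 * n → c k < r (k + 1)
  extremal : ∀ k, k + 1 < 2 * n → ∀ s ∈ Icc (r k) (r (k + 1)),
    (-1) ^ k * (nodePoly (2 * n) r).eval s ≤ (-1) ^ k * (nodePoly (2 * n) r).eval (c k)
  nondegenerate : ∀ k, k + 1 < 2 * n →
    (nodePoly (2 * n) r).derivative.derivative.eval (c k) ≠ 0
  eval_derivative_eq_zero_iff : ∀ s,
    (nodePoly (2 * n) r).derivative.eval s = 0 ↔ ∃ k, k + 1 < 2 * n ∧ s = c k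

/-- Each of the `2 n - 1` gaps between consecutive nodes contains a point at which the polynomial
is extremal on the gap; these are all the critical points, and they are nondegenerate, because the
derivative has degree at most `2 n - 1`. -/
lemma exists_critical_points {r : ℕ → ℝ} (hr : StrictMono r) {n : ℕ} (hn : 0 < n) :
    ∃ c : ℕ → ℝ, IsCriticalSeq n r c := by
  classical
  set f := nodePoly (2 * n) r with hf
  have hmax : ∀ k, ∃ x, k + 1 < 2 * n → x ∈ Ioo (r k) (r (k + 1)) ∧
      ∀ s ∈ Icc (r k) (r (k + 1)), (-1) ^ k * f.eval s ≤ (-1) ^ k * f.eval x := by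
    intro k
    by_cases hk : k + 1 < 2 * n
    swap
    · exact ⟨0, fun h => absurd h hk⟩
    have hlt : r k < r (k + 1) := hr k.lt_succ_self
    obtain ⟨x, hx, hxm⟩ := isCompact_Icc.exists_isMaxOn (nonempty_Icc.2 hlt.le)
      (f := fun s => (-1) ^ k * f.eval s) (by fun_prop)
    refine ⟨x, fun _ => ⟨?_, fun s hs => hxm hs⟩⟩
    have hmid := sign_nodePoly_gap hr hk (s := (r k + r (k + 1)) / 2) (by linarith) (by linarith)
    have hpos : 0 < (-1) ^ k * f.eval x :=
      hmid.trans_le (hxm (a := (r k + r (k + 1)) / 2) ⟨by linarith, by linarith⟩)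
    have hroot : ∀ j < 2 * n, f.eval (r j) = 0 := fun j hj => by
      rw [hf, eval_nodePoly, Finset.prod_eq_zero (Finset.mem_range.2 hj) (sub_self _), neg_zero]
    refine ⟨hx.1.lt_of_ne ?_, hx.2.lt_of_ne ?_⟩
    · intro h
      rw [← h, hroot k (by omega), mul_zero] at hpos
      exact hpos.false
    · intro h
      rw [h, hroot _ hk, mul_zero] at hpos
      exact hpos.false
  choose c hc using hmax
  have hcrit : ∀ k, k + 1 < 2 * n → f.derivative.eval (c k) = 0 := by
    intro k hk
    obtain ⟨hx, hm⟩ := hc k hk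
    have hloc : IsLocalMax (fun s => (-1) ^ k * f.eval s) (c k) := by
      filter_upwards [Icc_mem_nhds hx.1 hx.2] with s hs using hm s hs
    have h0 := hloc.deriv_eq_zero
    rw [deriv_const_mul_field, Polynomial.deriv] at h0
    exact (mul_eq_zero.1 h0).resolve_left (pow_ne_zero _ (by norm_num))
  have hinj : ∀ i j, i + 1 < 2 * n → j + 1 < 2 * n → c i = c j → i = j := by
    have key : ∀ i j, i + 1 < 2 * n → j + 1 < 2 * n → i < j → c i < c j := fun i j hi hj hij =>
      ((hc i hi).1.2.trans_le (hr.monotone hij)).trans (hc j hj).1.1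
    intro i j hi hj h
    rcases lt_trichotomy i j with hij | hij | hij
    · exact absurd h (key i j hi hj hij).ne
    · exact hij
    · exact absurd h.symm (key j i hj hi hij).ne
  have hfdeg : f.natDegree = 2 * n := natDegree_nodePoly _ _
  have hd0 : f.derivative ≠ 0 := fun h => by
    have := Polynomial.derivative_eq_zero.1 h
    omega
  have hsub : (Finset.range (2 * n - 1)).image c ⊆ f.derivative.roots.toFinset := by
    intro x hx
    obtain ⟨k, hk, rfl⟩ := Finset.mem_image.1 hx
    rw [Finset.mem_range] at hk
    rw [Multiset.mem_toFinset, Polynomial.mem_roots hd0]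
    exact hcrit k (by omega)
  have hcard : ((Finset.range (2 * n - 1)).image c).card = 2 * n - 1 := by
    rw [Finset.card_image_of_injOn, Finset.card_range]
    intro i hi j hj h
    simp only [Finset.coe_range, mem_Iio] at hi hj
    exact hinj i j (by omega) (by omega) h
  have hle : Multiset.card f.derivative.roots ≤ 2 * n - 1 :=
    (Polynomial.card_roots' _).trans ((Polynomial.natDegree_derivative_le f).trans (by omega))
  have hle' := Multiset.toFinset_card_le f.derivative.roots
  have heq : (Finset.range (2 * n - 1)).image c = f.derivative.roots.toFinset :=
    Finset.eq_of_subset_of_card_le hsub (by omega)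
  have hnodup : f.derivative.roots.Nodup := by
    rw [← Multiset.toFinset_card_eq_card_iff_nodup, ← heq]
    have := Finset.card_le_card hsub
    omega
  refine ⟨c, fun k hk => (hc k hk).1.1, fun k hk => (hc k hk).1.2, fun k hk => (hc k hk).2,
    fun k hk h => ?_, fun s => ?_⟩
  · have h1 := (Polynomial.one_lt_rootMultiplicity_iff_isRoot hd0 (t := c k)).2 ⟨hcrit k hk, h⟩
    have h2 := Multiset.nodup_iff_count_le_one.1 hnodup (c k)
    rw [Polynomial.count_roots] at h2
    omega
  · constructor
    · intro h
      have : s ∈ f.derivative.roots.toFinset := by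
        rw [Multiset.mem_toFinset, Polynomial.mem_roots hd0]
        exact h
      rw [← heq] at this
      obtain ⟨k, hk, rfl⟩ := Finset.mem_image.1 this
      exact ⟨k, by have := Finset.mem_range.1 hk; omega, rfl⟩
    · rintro ⟨k, hk, rfl⟩
      exact hcrit k hk

/-! ### Behaviour of a real polynomial on a horizontal strip -/

/-- The filter of points of the strip `|Im z| ≤ 2` whose real part tends to `±∞`. -/
noncomputable def stripInfty : Filter ℂ :=
  comap (fun z : ℂ => |z.re|) atTop ⊓ 𝓟 {z : ℂ | |z.im| ≤ 2}

lemma eventually_stripInfty {p : ℂ → Prop} (h : ∀ᶠ z in stripInfty, p z) :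
    ∃ M : ℝ, ∀ z : ℂ, |z.im| ≤ 2 → M ≤ |z.re| → p z := by
  rw [stripInfty, eventually_inf_principal, eventually_comap] at h
  obtain ⟨M, hM⟩ := eventually_atTop.1 h
  exact ⟨M, fun z hz hre => hM _ hre z rfl hz⟩

lemma tendsto_abs_re_stripInfty : Tendsto (fun z : ℂ => |z.re|) stripInfty atTop :=
  tendsto_comap.mono_left inf_le_left

lemma eventually_abs_im_stripInfty : ∀ᶠ z in stripInfty, |z.im| ≤ 2 :=
  mem_inf_of_right (mem_principal_self _)

lemma tendsto_div_re_stripInfty : Tendsto (fun z : ℂ => z / z.re) stripInfty (𝓝 1) := by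
  have h0 : Tendsto (fun z : ℂ => 2 * |z.re|⁻¹) stripInfty (𝓝 0) := by
    simpa using (tendsto_inv_atTop_zero.comp tendsto_abs_re_stripInfty).const_mul (2 : ℝ)
  rw [tendsto_iff_norm_sub_tendsto_zero]
  refine squeeze_zero' (Eventually.of_forall fun z => norm_nonneg _) ?_ h0
  filter_upwards [eventually_abs_im_stripInfty,
    tendsto_abs_re_stripInfty.eventually_gt_atTop 0] with z him hre
  have hre0 : (z.re : ℂ) ≠ 0 := by simpa using hre
  have : z / z.re - 1 = z.im * Complex.I / z.re := by
    rw [div_sub_one hre0]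
    congr 1
    nth_rewrite 1 [← Complex.re_add_im z]
    ring
  rw [this, norm_div, norm_mul, Complex.norm_I, Complex.norm_real, Complex.norm_real, mul_one,
    div_eq_mul_inv, Real.norm_eq_abs, Real.norm_eq_abs]
  gcongr

/-- On a horizontal strip a real polynomial is asymptotic to its leading monomial in `Re z`. -/
lemma tendsto_aeval_div_re_pow (Q : ℝ[X]) {m : ℕ} (hm : Q.natDegree ≤ m) :
    Tendsto (fun z : ℂ => aeval z Q / (z.re : ℂ) ^ m) stripInfty (𝓝 (Q.coeff m : ℂ)) := by
  have hinv : Tendsto (fun z : ℂ => ((z.re : ℂ))⁻¹) stripInfty (𝓝 0) := by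
    rw [tendsto_zero_iff_norm_tendsto_zero]
    refine (tendsto_inv_atTop_zero.comp tendsto_abs_re_stripInfty).congr fun z => ?_
    simp
  have hterm : ∀ i ∈ Finset.range (m + 1), Tendsto
      (fun z : ℂ => (Q.coeff i : ℂ) * ((z / z.re) ^ i * ((z.re : ℂ))⁻¹ ^ (m - i))) stripInfty
      (𝓝 ((Q.coeff i : ℂ) * (1 ^ i * 0 ^ (m - i)))) := fun i _ =>
    ((tendsto_div_re_stripInfty.pow i).mul (hinv.pow (m - i))).const_mul _
  have hsum := tendsto_finsetSum (Finset.range (m + 1)) hterm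
  have hlim : ∑ i ∈ Finset.range (m + 1), (Q.coeff i : ℂ) * (1 ^ i * 0 ^ (m - i))
      = Q.coeff m := by
    rw [Finset.sum_range_succ, Finset.sum_eq_zero]
    · simp
    · intro i hi
      rw [Finset.mem_range] at hi
      rw [zero_pow (by omega), mul_zero, mul_zero]
  rw [hlim] at hsum
  refine hsum.congr' ?_
  filter_upwards [tendsto_abs_re_stripInfty.eventually_gt_atTop 0] with z hre
  have hre0 : (z.re : ℂ) ≠ 0 := by simpa using hre
  rw [aeval_eq_sum_range' (Nat.lt_succ_of_le hm), Finset.sum_div]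
  refine Finset.sum_congr rfl fun i hi => ?_
  have hi' : i ≤ m := Nat.lt_succ_iff.1 (Finset.mem_range.1 hi)
  rw [Algebra.smul_def, Complex.coe_algebraMap, mul_div_assoc, div_pow]
  congr 1
  rw [inv_pow, div_mul_eq_mul_div, div_eq_div_iff (pow_ne_zero _ hre0) (pow_ne_zero _ hre0)]
  obtain ⟨j, rfl⟩ := Nat.exists_eq_add_of_le hi'
  rw [Nat.add_sub_cancel_left, pow_add]
  field_simp

/-- Quantitative control of a real polynomial `f` of degree `2 n` with leading coefficient `-1` on
the strip `|Im z| ≤ 2`: the behaviour of the leading monomial for `|Re z| ≥ M`, and crude bounds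
for `|Re z| ≤ M`. -/
structure StripBounds (n : ℕ) (f : ℝ[X]) (M K : ℝ) : Prop where
  M_pos : 0 < M
  K_pos : 0 < K
  re_le : ∀ z : ℂ, |z.im| ≤ 2 → M ≤ |z.re| → (aeval z f).re ≤ -(3 / 4) * z.re ^ (2 * n)
  re_mul_derivative_neg : ∀ z : ℂ, |z.im| ≤ 2 → M ≤ |z.re| →
    z.re * (aeval z f.derivative).re < 0
  abs_im_le : ∀ z : ℂ, |z.im| ≤ 2 → M ≤ |z.re| →
    |(aeval z f.derivative.derivative).im| ≤ -(aeval z f.derivative.derivative).re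
  norm_le : ∀ z : ℂ, |z.im| ≤ 2 → |z.re| ≤ M → ‖aeval z f‖ ≤ K
  norm_derivative_le : ∀ z : ℂ, |z.im| ≤ 2 → |z.re| ≤ M → ‖aeval z f.derivative‖ ≤ K
  abs_im_derivative_le : ∀ z : ℂ, |z.im| ≤ 2 → |z.re| ≤ M →
    |(aeval z f.derivative).im| ≤ K * |z.im|
  norm_derivative2_le : ∀ z : ℂ, |z.im| ≤ 2 →
    ‖aeval z f.derivative.derivative‖ ≤ K * (1 + |z.re|) ^ (2 * n - 2)

lemma aeval_ofReal_im (Q : ℝ[X]) (s : ℝ) : (aeval (s : ℂ) Q).im = 0 := by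
  have : aeval (s : ℂ) Q = ((Q.eval s : ℝ) : ℂ) := by
    rw [← Complex.coe_algebraMap, aeval_algebraMap_apply]
    simp
  rw [this, Complex.ofReal_im]

lemma aeval_ofReal_re (Q : ℝ[X]) (s : ℝ) : (aeval (s : ℂ) Q).re = Q.eval s := by
  have : aeval (s : ℂ) Q = ((Q.eval s : ℝ) : ℂ) := by
    rw [← Complex.coe_algebraMap, aeval_algebraMap_apply]
    simp
  rw [this, Complex.ofReal_re]

lemma isCompact_rectangle (M : ℝ) : IsCompact {z : ℂ | |z.im| ≤ 2 ∧ |z.re| ≤ M} := by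
  refine Metric.isCompact_of_isClosed_isBounded ?_ ?_
  · exact (isClosed_le Complex.continuous_im.abs continuous_const).inter
      (isClosed_le Complex.continuous_re.abs continuous_const)
  · refine (Metric.isBounded_closedBall (x := (0 : ℂ)) (r := M + 2)).subset fun z hz => ?_
    rw [mem_closedBall_zero_iff]
    exact (Complex.norm_le_abs_re_add_abs_im z).trans (by linarith [hz.1, hz.2])

lemma exists_norm_aeval_le (Q : ℝ[X]) (M : ℝ) :
    ∃ K : ℝ, ∀ z : ℂ, |z.im| ≤ 2 → |z.re| ≤ M → ‖aeval z Q‖ ≤ K := by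
  obtain ⟨K, hK⟩ := (isCompact_rectangle M).exists_bound_of_continuousOn
    (f := fun z : ℂ => aeval z Q) (by fun_prop)
  exact ⟨K, fun z h1 h2 => hK z ⟨h1, h2⟩⟩

/-- A real polynomial is real on the real axis, so its imaginary part is `O(|Im z|)`. -/
lemma exists_abs_im_aeval_le (Q : ℝ[X]) (M : ℝ) :
    ∃ K : ℝ, ∀ z : ℂ, |z.im| ≤ 2 → |z.re| ≤ M → |(aeval z Q).im| ≤ K * |z.im| := by
  obtain ⟨K, hK⟩ := exists_norm_aeval_le Q.derivative M
  refine ⟨K, fun z h1 h2 => ?_⟩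
  have hconv : Convex ℝ {w : ℂ | |w.im| ≤ 2 ∧ |w.re| ≤ M} := by
    have h : {w : ℂ | |w.im| ≤ 2 ∧ |w.re| ≤ M} =
        Complex.imLm ⁻¹' (Icc (-2) 2) ∩ Complex.reLm ⁻¹' (Icc (-M) M) := by
      ext w; simp [abs_le]
    rw [h]
    exact ((convex_Icc _ _).linear_preimage _).inter ((convex_Icc _ _).linear_preimage _)
  have := hconv.norm_image_sub_le_of_norm_hasDerivWithin_le (f := fun w : ℂ => aeval w Q)
    (f' := fun w => aeval w Q.derivative) (C := K)
    (fun w _ => (Q.hasDerivAt_aeval w).hasDerivWithinAt) (fun w hw => hK w hw.1 hw.2)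
    (x := (z.re : ℂ)) (y := z) (by simpa using h2) ⟨h1, h2⟩
  have hz : z - z.re = z.im * Complex.I := by
    nth_rewrite 1 [← Complex.re_add_im z]; ring
  rw [hz, norm_mul, Complex.norm_I, mul_one, Complex.norm_real, Real.norm_eq_abs] at this
  refine le_trans ?_ ((Complex.abs_im_le_norm _).trans this)
  rw [Complex.sub_im, aeval_ofReal_im, sub_zero]

lemma coeff_derivative_top {f : ℝ[X]} {m : ℕ} (hm : 0 < m) :
    f.derivative.coeff (m - 1) = f.coeff m * m := by
  obtain ⟨k, rfl⟩ := Nat.exists_eq_succ_of_ne_zero hm.ne'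
  simp [coeff_derivative]

/-- On the strip, `aeval z Q = (Re z)^m * w` with `w` close to the coefficient of degree `m`. -/
lemma exists_eq_pow_mul (Q : ℝ[X]) {m : ℕ} (hm : Q.natDegree ≤ m) :
    ∃ M : ℝ, ∀ z : ℂ, |z.im| ≤ 2 → M ≤ |z.re| → ∃ w : ℂ, ‖w - Q.coeff m‖ ≤ 1 / 4 ∧
      aeval z Q = ((z.re ^ m : ℝ) : ℂ) * w := by
  have h := (tendsto_aeval_div_re_pow Q hm).eventually
    (Metric.closedBall_mem_nhds _ (by norm_num : (0 : ℝ) < 1 / 4))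
  obtain ⟨M, hM⟩ := eventually_stripInfty h
  refine ⟨max M 1, fun z h1 h2 => ⟨_, mem_closedBall_iff_norm.1 (hM z h1 (le_of_max_le_left h2)),
    ?_⟩⟩
  have : (z.re : ℂ) ≠ 0 := by
    have := (le_max_right M 1).trans h2
    intro h
    rw [Complex.ofReal_eq_zero] at h
    norm_num [h] at this
  push_cast
  field_simp

lemma exists_stripBounds {n : ℕ} (hn : 0 < n) {f : ℝ[X]} (hdeg : f.natDegree = 2 * n)
    (hlead : f.leadingCoeff = -1) : ∃ M K : ℝ, StripBounds n f M K := by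
  have hc0 : f.coeff (2 * n) = -1 := by rw [← hdeg]; exact hlead
  have hd1 : f.derivative.natDegree ≤ 2 * n - 1 := hdeg ▸ natDegree_derivative_le f
  have hd2 : f.derivative.derivative.natDegree ≤ 2 * n - 1 - 1 :=
    (natDegree_derivative_le _).trans (Nat.sub_le_sub_right hd1 1)
  have hc1 : f.derivative.coeff (2 * n - 1) = -(2 * n) := by
    rw [coeff_derivative_top (by omega), hc0]; push_cast; ring
  have hc2 : f.derivative.derivative.coeff (2 * n - 1 - 1) = -(2 * n) * (2 * n - 1) := by
    rw [coeff_derivative_top (by omega), hc1, Nat.cast_sub (by omega)]; push_cast; ring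
  have hn1 : (1 : ℝ) ≤ n := by exact_mod_cast hn
  obtain ⟨M0, h0⟩ := exists_eq_pow_mul f hdeg.le
  obtain ⟨M1, h1⟩ := exists_eq_pow_mul _ hd1
  obtain ⟨M2, h2⟩ := exists_eq_pow_mul _ hd2
  rw [hc0] at h0
  rw [hc1] at h1
  rw [hc2, Nat.sub_sub] at h2
  set M := max (max M0 M1) (max M2 1) with hM
  have hM0 : M0 ≤ M := (le_max_left _ _).trans (le_max_left _ _)
  have hM1 : M1 ≤ M := (le_max_right _ _).trans (le_max_left _ _)
  have hM2 : M2 ≤ M := (le_max_left _ _).trans (le_max_right _ _)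
  have hM3 : 1 ≤ M := (le_max_right _ _).trans (le_max_right _ _)
  obtain ⟨K0, k0⟩ := exists_norm_aeval_le f M
  obtain ⟨K1, k1⟩ := exists_norm_aeval_le f.derivative M
  obtain ⟨K2, k2⟩ := exists_norm_aeval_le f.derivative.derivative M
  obtain ⟨K3, k3⟩ := exists_abs_im_aeval_le f.derivative M
  -- bound on `‖F''(z)‖ / |Re z| ^ (2 n - 2)` at infinity
  set K4 : ℝ := 2 * n * (2 * n - 1) + 1 / 4 with hK4
  set K := |K0| + |K1| + |K2| + |K3| + |K4| + 1 with hK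
  have p0 := abs_nonneg K0
  have p1 := abs_nonneg K1
  have p2 := abs_nonneg K2
  have p3 := abs_nonneg K3
  have p4 := abs_nonneg K4
  have q0 := le_abs_self K0
  have q1 := le_abs_self K1
  have q2 := le_abs_self K2
  have q3 := le_abs_self K3
  have q4 := le_abs_self K4
  refine ⟨M, K, ⟨by linarith, by linarith, ?_, ?_, ?_, ?_, ?_, ?_, ?_⟩⟩
  · intro z hz hre
    obtain ⟨w, hw, hzw⟩ := h0 z hz (hM0.trans hre)
    rw [hzw, Complex.re_ofReal_mul, mul_comm]
    have := (Complex.abs_re_le_norm _).trans hw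
    rw [Complex.sub_re, Complex.ofReal_re, abs_le] at this
    exact mul_le_mul_of_nonneg_right (by linarith) ((even_two_mul n).pow_nonneg _)
  · intro z hz hre
    obtain ⟨w, hw, hzw⟩ := h1 z hz (hM1.trans hre)
    rw [hzw, Complex.re_ofReal_mul, ← mul_assoc, ← pow_succ', Nat.sub_add_cancel (by omega)]
    have := (Complex.abs_re_le_norm _).trans hw
    rw [Complex.sub_re, Complex.ofReal_re, abs_le] at this
    refine mul_neg_of_pos_of_neg ((even_two_mul n).pow_pos ?_) (by linarith)
    intro h
    rw [h, abs_zero] at hre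
    linarith
  · intro z hz hre
    obtain ⟨w, hw, hzw⟩ := h2 z hz (hM2.trans hre)
    rw [hzw, Complex.re_ofReal_mul, Complex.im_ofReal_mul]
    have hr := (Complex.abs_re_le_norm _).trans hw
    have hi := (Complex.abs_im_le_norm _).trans hw
    rw [Complex.sub_re, Complex.ofReal_re, abs_le] at hr
    rw [Complex.sub_im, Complex.ofReal_im, sub_zero] at hi
    have hp : 0 ≤ z.re ^ (2 * n - (1 + 1)) := Even.pow_nonneg (by grind) _
    rw [abs_mul, abs_of_nonneg hp, ← mul_neg]
    refine mul_le_mul_of_nonneg_left (hi.trans ?_) hp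
    nlinarith
  · exact fun z hz hre => (k0 z hz hre).trans (by linarith)
  · exact fun z hz hre => (k1 z hz hre).trans (by linarith)
  · exact fun z hz hre => (k3 z hz hre).trans
      (mul_le_mul_of_nonneg_right (by linarith) (abs_nonneg _))
  · intro z hz
    have hone : 1 ≤ (1 + |z.re|) ^ (2 * n - 2) := one_le_pow₀ (by linarith [abs_nonneg z.re])
    rcases le_total |z.re| M with hre | hre
    · refine (k2 z hz hre).trans ?_
      nlinarith
    · obtain ⟨w, hw, hzw⟩ := h2 z hz (hM2.trans hre)
      rw [hzw, norm_mul, Complex.norm_real, Real.norm_eq_abs, abs_pow, mul_comm]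
      have hwn : ‖w‖ ≤ K4 := by
        have := norm_le_norm_sub_add w ((-(2 * n) * (2 * n - 1) : ℝ) : ℂ)
        rw [Complex.norm_real, Real.norm_eq_abs, abs_of_nonpos (by nlinarith)] at this
        rw [hK4]
        linarith
      exact mul_le_mul (by linarith) (pow_le_pow_left₀ (abs_nonneg _) (by linarith) _)
        (by positivity) (by linarith)

/-! ### The torsion function and its derivatives -/

/-- The constant `1 / (2 (d - 1))`, the value of the quadratic part of `u_ε` on the axis. -/
noncomputable def crossCoeff (d : ℕ) : ℝ := 1 / (2 * ((d : ℝ) - 1))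

lemma crossCoeff_pos {d : ℕ} (hd : 2 ≤ d) : 0 < crossCoeff d := by
  have : (2 : ℝ) ≤ d := by exact_mod_cast hd
  unfold crossCoeff
  have : 0 < (d : ℝ) - 1 := by linarith
  positivity

lemma two_mul_crossCoeff {d : ℕ} (hd : 2 ≤ d) : 2 * crossCoeff d = 1 / ((d : ℝ) - 1) := by
  have : (2 : ℝ) ≤ d := by exact_mod_cast hd
  have : (d : ℝ) - 1 ≠ 0 := by linarith
  unfold crossCoeff
  field_simp

/-- The orthogonal projection `x ↦ (0, x₂, …, x_d)`. -/
noncomputable def crossProj {d : ℕ} (hd : 2 ≤ d) :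
    EuclideanSpace ℝ (Fin d) →L[ℝ] EuclideanSpace ℝ (Fin d) :=
  ContinuousLinearMap.id ℝ _ -
    (EuclideanSpace.proj (i₁ hd)).smulRight (EuclideanSpace.single (i₁ hd) (1 : ℝ))

/-- The map `x ↦ x₁ + i x₂`. -/
noncomputable def planeMap {d : ℕ} (hd : 2 ≤ d) : EuclideanSpace ℝ (Fin d) →L[ℝ] ℂ :=
  (EuclideanSpace.proj (i₁ hd)).smulRight (1 : ℂ) +
    (EuclideanSpace.proj (i₂ hd)).smulRight Complex.I

/-- The point `(s, 0, …, 0)` of the axis. -/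
noncomputable def axisPt {d : ℕ} (hd : 2 ≤ d) (s : ℝ) : EuclideanSpace ℝ (Fin d) :=
  EuclideanSpace.single (i₁ hd) s

/-- The function `(1 - x₂² - ⋯ - x_d²) / (2 (d - 1)) + ε Re f(x₁ + i x₂)` for a real
polynomial `f`. -/
noncomputable def torsionFn {d : ℕ} (hd : 2 ≤ d) (f : ℝ[X]) (ε : ℝ)
    (x : EuclideanSpace ℝ (Fin d)) : ℝ :=
  crossCoeff d * (1 - ‖crossProj hd x‖ ^ 2) + ε * (aeval (planeMap hd x) f).re

section

variable {d : ℕ} (hd : 2 ≤ d)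

lemma i₁_ne_i₂ : i₁ hd ≠ i₂ hd := by simp [i₁, i₂]

lemma crossProj_apply (x : EuclideanSpace ℝ (Fin d)) (i : Fin d) :
    crossProj hd x i = if i = i₁ hd then 0 else x i := by
  by_cases h : i = i₁ hd
  · subst h; simp [crossProj]
  · simp [crossProj, h]

lemma planeMap_apply (x : EuclideanSpace ℝ (Fin d)) :
    planeMap hd x = x (i₁ hd) + x (i₂ hd) * Complex.I := by
  simp [planeMap]

@[simp] lemma planeMap_re (x : EuclideanSpace ℝ (Fin d)) : (planeMap hd x).re = x (i₁ hd) := by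
  simp [planeMap_apply]

@[simp] lemma planeMap_im (x : EuclideanSpace ℝ (Fin d)) : (planeMap hd x).im = x (i₂ hd) := by
  simp [planeMap_apply]

lemma inner_crossProj (x h : EuclideanSpace ℝ (Fin d)) :
    inner ℝ (crossProj hd x) (crossProj hd h) =
      ∑ i ∈ Finset.univ.erase (i₁ hd), x i * h i := by
  rw [PiLp.inner_apply, ← Finset.add_sum_erase _ _ (Finset.mem_univ (i₁ hd))]
  rw [crossProj_apply, if_pos rfl, inner_zero_left, zero_add]
  refine Finset.sum_congr rfl fun i hi => ?_
  rw [crossProj_apply, crossProj_apply, if_neg (Finset.ne_of_mem_erase hi),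
    if_neg (Finset.ne_of_mem_erase hi)]
  simp [mul_comm]

lemma norm_crossProj_sq (x : EuclideanSpace ℝ (Fin d)) :
    ‖crossProj hd x‖ ^ 2 = crossSq hd x := by
  rw [← real_inner_self_eq_norm_sq, inner_crossProj, crossSq]
  exact Finset.sum_congr rfl fun i _ => by ring

lemma abs_i₂_le (x : EuclideanSpace ℝ (Fin d)) : |x (i₂ hd)| ≤ ‖crossProj hd x‖ := by
  have h := PiLp.norm_apply_le (crossProj hd x) (i₂ hd)
  rwa [crossProj_apply, if_neg (i₁_ne_i₂ hd).symm, Real.norm_eq_abs] at h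

lemma axisPt_add_crossProj (x : EuclideanSpace ℝ (Fin d)) :
    axisPt hd (x (i₁ hd)) + crossProj hd x = x := by
  ext i
  rw [PiLp.add_apply, crossProj_apply, axisPt]
  by_cases h : i = i₁ hd
  · subst h; simp
  · simp [h]

@[simp] lemma axisPt_i₁ (s : ℝ) : axisPt hd s (i₁ hd) = s := by simp [axisPt]

@[simp] lemma axisPt_i₂ (s : ℝ) : axisPt hd s (i₂ hd) = 0 := by
  simp [axisPt, (i₁_ne_i₂ hd).symm]

@[simp] lemma crossProj_axisPt (s : ℝ) : crossProj hd (axisPt hd s) = 0 := by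
  ext i
  rw [crossProj_apply, axisPt]
  by_cases h : i = i₁ hd
  · simp [h]
  · simp [h]

@[simp] lemma crossProj_crossProj (x : EuclideanSpace ℝ (Fin d)) :
    crossProj hd (crossProj hd x) = crossProj hd x := by
  ext i
  simp only [crossProj_apply]
  split_ifs <;> rfl

@[simp] lemma crossProj_i₁ (x : EuclideanSpace ℝ (Fin d)) : crossProj hd x (i₁ hd) = 0 := by
  simp [crossProj_apply]

@[simp] lemma crossProj_i₂ (x : EuclideanSpace ℝ (Fin d)) :
    crossProj hd x (i₂ hd) = x (i₂ hd) := by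
  rw [crossProj_apply, if_neg (i₁_ne_i₂ hd).symm]

lemma planeMap_axisPt (s : ℝ) : planeMap hd (axisPt hd s) = s := by
  simp [planeMap_apply]

lemma planeMap_crossProj (x : EuclideanSpace ℝ (Fin d)) :
    planeMap hd (crossProj hd x) = x (i₂ hd) * Complex.I := by
  simp [planeMap_apply]

lemma norm_le_abs_add_norm_crossProj (x : EuclideanSpace ℝ (Fin d)) :
    ‖x‖ ≤ |x (i₁ hd)| + ‖crossProj hd x‖ := by
  nth_rewrite 1 [← axisPt_add_crossProj hd x]
  refine (norm_add_le _ _).trans ?_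
  rw [axisPt, PiLp.norm_single, Real.norm_eq_abs]

lemma axisPt_eq_smul (s : ℝ) : axisPt hd s = s • axisPt hd 1 := by
  ext i
  by_cases h : i = i₁ hd <;> simp [axisPt, h]

lemma continuous_axisPt : Continuous (axisPt hd) := by
  rw [funext (axisPt_eq_smul hd)]
  fun_prop

variable (f : ℝ[X]) (ε : ℝ)

lemma u_eq_torsionFn {n : ℕ} {a : Fin n → ℝ} {f : ℝ[X]} (hf : ∀ z : ℂ, holF a z = aeval z f) :
    u hd a ε = torsionFn hd f ε := by
  ext x
  rw [u, torsionFn, norm_crossProj_sq, v, hf, planeMap_apply, crossCoeff]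

lemma torsionFn_axisPt (s : ℝ) : torsionFn hd f ε (axisPt hd s) = crossCoeff d + ε * f.eval s := by
  simp [torsionFn, planeMap_axisPt, aeval_ofReal_re]

lemma hasFDerivAt_aeval_planeMap (x : EuclideanSpace ℝ (Fin d)) :
    HasFDerivAt (fun x => aeval (planeMap hd x) f)
      ((aeval (planeMap hd x) f.derivative) • planeMap hd) x := by
  have h := ((f.hasDerivAt_aeval (planeMap hd x)).complexToReal_fderiv).comp x
    (planeMap hd).hasFDerivAt
  refine h.congr_fderiv ?_
  ext y
  simp

/-- The differential of `torsionFn`. -/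
noncomputable def dTorsionFn (x : EuclideanSpace ℝ (Fin d)) : EuclideanSpace ℝ (Fin d) →L[ℝ] ℝ :=
  -(2 * crossCoeff d) • (innerSL ℝ (crossProj hd x)).comp (crossProj hd) +
    ε • Complex.reCLM.comp ((aeval (planeMap hd x) f.derivative) • planeMap hd)

lemma dTorsionFn_apply (x h : EuclideanSpace ℝ (Fin d)) :
    dTorsionFn hd f ε x h = -(2 * crossCoeff d) * inner ℝ (crossProj hd x) (crossProj hd h) +
      ε * (aeval (planeMap hd x) f.derivative * planeMap hd h).re := by
  simp [dTorsionFn]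

lemma hasFDerivAt_torsionFn (x : EuclideanSpace ℝ (Fin d)) :
    HasFDerivAt (torsionFn hd f ε) (dTorsionFn hd f ε x) x := by
  have h1 := ((crossProj hd).hasFDerivAt (x := x)).norm_sq
  have h2 := (Complex.reCLM.hasFDerivAt (x := aeval (planeMap hd x) f)).comp x
    (hasFDerivAt_aeval_planeMap hd f x)
  have h := ((h1.const_sub 1).const_mul (crossCoeff d)).add (h2.const_mul ε)
  refine h.congr_fderiv ?_
  ext y
  simp [dTorsionFn_apply]
  ring

lemma fderiv_torsionFn (x : EuclideanSpace ℝ (Fin d)) :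
    fderiv ℝ (torsionFn hd f ε) x = dTorsionFn hd f ε x :=
  (hasFDerivAt_torsionFn hd f ε x).fderiv

lemma contDiff_torsionFn {m : ℕ∞ω} : ContDiff ℝ m (torsionFn hd f ε) := by
  have h : ContDiff ℝ m fun x => aeval (planeMap hd x) f := by
    simp_rw [aeval_eq_sum_range]
    fun_prop
  unfold torsionFn
  have h1 := Complex.reCLM.contDiff.comp h
  have h2 : ContDiff ℝ m fun x => ‖crossProj hd x‖ ^ 2 := (crossProj hd).contDiff.norm_sq ℝ
  exact (contDiff_const.mul (contDiff_const.sub h2)).add (contDiff_const.mul h1)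

lemma continuous_torsionFn : Continuous (torsionFn hd f ε) :=
  (contDiff_torsionFn hd f ε (m := 0)).continuous

/-- The second differential of `torsionFn`. -/
noncomputable def hessTorsionFn (x h k : EuclideanSpace ℝ (Fin d)) : ℝ :=
  -(2 * crossCoeff d) * inner ℝ (crossProj hd h) (crossProj hd k) +
    ε * (aeval (planeMap hd x) f.derivative.derivative * planeMap hd h * planeMap hd k).re

lemma hasFDerivAt_dTorsionFn_apply (x k : EuclideanSpace ℝ (Fin d)) :
    ∃ D : EuclideanSpace ℝ (Fin d) →L[ℝ] ℝ, (∀ h, D h = hessTorsionFn hd f ε x h k) ∧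
      HasFDerivAt (fun y => dTorsionFn hd f ε y k) D x := by
  have h1 := ((innerSL ℝ (crossProj hd k)).comp (crossProj hd)).hasFDerivAt (x := x)
  have h2 := (Complex.reCLM.comp ((ContinuousLinearMap.mul ℝ ℂ) (planeMap hd k))).hasFDerivAt.comp x
    (hasFDerivAt_aeval_planeMap hd f.derivative x)
  have h := (h1.const_mul (-(2 * crossCoeff d))).add (h2.const_mul ε)
  refine ⟨_, fun y => ?_, h.congr_of_eventuallyEq (Eventually.of_forall fun y => ?_)⟩
  · have : planeMap hd k * (aeval (planeMap hd x) f.derivative.derivative * planeMap hd y) =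
      aeval (planeMap hd x) f.derivative.derivative * planeMap hd y * planeMap hd k := by ring
    rw [hessTorsionFn, ← this, real_inner_comm]
    rfl
  · have : planeMap hd k * aeval (planeMap hd y) f.derivative =
      aeval (planeMap hd y) f.derivative * planeMap hd k := by ring
    refine (dTorsionFn_apply hd f ε y k).trans ?_
    rw [← this, real_inner_comm]
    rfl

lemma iteratedFDeriv_two_torsionFn (x h k : EuclideanSpace ℝ (Fin d)) :
    iteratedFDeriv ℝ 2 (torsionFn hd f ε) x ![h, k] = hessTorsionFn hd f ε x h k := by
  rw [iteratedFDeriv_two_apply]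
  have hdiff : DifferentiableAt ℝ (fderiv ℝ (torsionFn hd f ε)) x :=
    ((contDiff_torsionFn hd f ε (m := 2)).fderiv_right (m := 1) le_rfl).differentiable
      one_ne_zero x
  obtain ⟨D, hD, hD'⟩ := hasFDerivAt_dTorsionFn_apply hd f ε x k
  have h1 := hdiff.hasFDerivAt.clm_apply (hasFDerivAt_const k x)
  have h2 : HasFDerivAt (fun y => fderiv ℝ (torsionFn hd f ε) y k) D x := by
    simpa only [fderiv_torsionFn] using hD'
  have := congrArg (fun L : EuclideanSpace ℝ (Fin d) →L[ℝ] ℝ => L h) (h1.unique h2)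
  simp only [hD] at this
  simpa using this

lemma sum_hess_eq : ∀ x : EuclideanSpace ℝ (Fin d),
    ∑ i, hessTorsionFn hd f ε x (EuclideanSpace.single i 1) (EuclideanSpace.single i 1) = -1 := by
  intro x
  have hd' : (2 : ℝ) ≤ d := by exact_mod_cast hd
  simp only [hessTorsionFn, Finset.sum_add_distrib, ← Finset.mul_sum, mul_assoc, ← Complex.re_sum]
  have h1 : ∑ i : Fin d, planeMap hd (EuclideanSpace.single i 1) *
      planeMap hd (EuclideanSpace.single i 1) = 0 := by
    rw [← Finset.add_sum_erase _ _ (Finset.mem_univ (i₁ hd)), ← Finset.add_sum_erase _ _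
      (Finset.mem_erase.2 ⟨(i₁_ne_i₂ hd).symm, Finset.mem_univ (i₂ hd)⟩), Finset.sum_eq_zero]
    · simp [planeMap_apply, i₁_ne_i₂ hd, (i₁_ne_i₂ hd).symm]
    · intro i hi
      simp only [Finset.mem_erase] at hi
      simp [planeMap_apply, hi.1.symm, hi.2.1.symm]
  have h2 : ∑ i : Fin d, inner ℝ (crossProj hd (EuclideanSpace.single i 1))
      (crossProj hd (EuclideanSpace.single i 1)) = (d : ℝ) - 1 := by
    have : ∀ i : Fin d, inner ℝ (crossProj hd (EuclideanSpace.single i (1 : ℝ)))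
      (crossProj hd (EuclideanSpace.single i 1)) = if i = i₁ hd then (0 : ℝ) else 1 := by
      intro i
      rw [inner_crossProj]
      split_ifs with h
      · refine Finset.sum_eq_zero fun j hj => ?_
        simp [h, Finset.ne_of_mem_erase hj]
      · rw [Finset.sum_eq_single_of_mem i (Finset.mem_erase.2 ⟨h, Finset.mem_univ _⟩)]
        · simp
        · intro j _ hj
          simp [hj]
    simp_rw [this]
    rw [Finset.sum_ite, Finset.sum_const_zero, zero_add, Finset.sum_const, Finset.filter_ne',
      Finset.card_erase_of_mem (Finset.mem_univ _), Finset.card_univ, Fintype.card_fin,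
      nsmul_eq_mul, mul_one, Nat.cast_sub (by omega), Nat.cast_one]
  rw [h1, h2, mul_zero, Complex.zero_re, mul_zero, add_zero, two_mul_crossCoeff hd]
  have : (d : ℝ) - 1 ≠ 0 := by linarith
  field_simp

lemma laplacian_torsionFn (x : EuclideanSpace ℝ (Fin d)) :
    Laplacian.laplacian (torsionFn hd f ε) x = -1 := by
  rw [InnerProductSpace.laplacian_eq_iteratedFDeriv_orthonormalBasis _
    (EuclideanSpace.basisFun (Fin d) ℝ)]
  simp only [EuclideanSpace.basisFun_apply, iteratedFDeriv_two_torsionFn]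
  exact sum_hess_eq hd f ε x

/-- On the axis the Hessian is diagonal, with entries `ε f''`, `-1 / (d - 1) - ε f''`, and
`-1 / (d - 1)` otherwise. -/
lemma hessian_axisPt (s : ℝ) : hessian (torsionFn hd f ε) (axisPt hd s) =
    Matrix.diagonal fun i => if i = i₁ hd then ε * f.derivative.derivative.eval s else
      -(2 * crossCoeff d) - if i = i₂ hd then ε * f.derivative.derivative.eval s else 0 := by
  ext i j
  rw [hessian, Matrix.of_apply, iteratedFDeriv_two_torsionFn, hessTorsionFn, inner_crossProj,
    planeMap_axisPt, Matrix.diagonal_apply]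
  have hne := i₁_ne_i₂ hd
  have hre := aeval_ofReal_re f.derivative.derivative s
  have him := aeval_ofReal_im f.derivative.derivative s
  have hsum : ∑ l ∈ Finset.univ.erase (i₁ hd), (EuclideanSpace.single i (1 : ℝ)) l *
      (EuclideanSpace.single j (1 : ℝ)) l = if i = j ∧ i ≠ i₁ hd then 1 else 0 := by
    by_cases h : i = i₁ hd
    · rw [if_neg (by simp [h])]
      refine Finset.sum_eq_zero fun l hl => ?_
      simp [h, Finset.ne_of_mem_erase hl]
    · rw [Finset.sum_eq_single_of_mem i (Finset.mem_erase.2 ⟨h, Finset.mem_univ _⟩)]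
      · by_cases hij : i = j
        · subst hij; simp [h]
        · simp [hij]
      · intro l _ hl
        simp [hl]
  rw [hsum]
  by_cases hij : i = j
  · subst hij
    by_cases h1 : i = i₁ hd
    · subst h1
      simp [planeMap_apply, hne, hre]
    · by_cases h2 : i = i₂ hd
      · subst h2
        simp [planeMap_apply, hne, hne.symm, hre]
        ring
      · simp [planeMap_apply, h1, h2, Ne.symm h1, Ne.symm h2]
  · simp only [hij, false_and, if_false, mul_zero, zero_add]
    by_cases hi1 : i = i₁ hd
    · have hj1 : j ≠ i₁ hd := fun h => hij (hi1.trans h.symm)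
      subst hi1
      simp [planeMap_apply, hne, him, hj1.symm]
    · by_cases hi2 : i = i₂ hd
      · have hj1 : j ≠ i₂ hd := fun h => hij (hi2.trans h.symm)
        subst hi2
        simp [planeMap_apply, hne, him, hj1.symm]
      · simp [planeMap_apply, Ne.symm hi1, Ne.symm hi2]

end

/-! ### Uniform bounds on all derivatives -/

/-- `g` is smooth, all its derivatives are `O(w ^ m)`, and those of order above `m` vanish; for a
weight `w` of linear growth this is what a polynomial of degree at most `m` satisfies. -/
structure PolyControl {E 𝔸 : Type*} [NormedAddCommGroup E] [NormedSpace ℝ E] [NormedRing 𝔸]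
    [NormedAlgebra ℝ 𝔸] (w : E → ℝ) (m : ℕ) (g : E → 𝔸) : Prop where
  contDiff : ContDiff ℝ ∞ g
  bound : ∀ k : ℕ, ∃ C : ℝ, 0 ≤ C ∧ ∀ x, ‖iteratedFDeriv ℝ k g x‖ ≤ C * w x ^ m
  vanish : ∀ k : ℕ, m < k → ∀ x, ‖iteratedFDeriv ℝ k g x‖ = 0

namespace PolyControl

variable {E 𝔸 : Type*} [NormedAddCommGroup E] [NormedSpace ℝ E] [NormedRing 𝔸]
    [NormedAlgebra ℝ 𝔸] {w : E → ℝ} {m m' : ℕ} {g h : E → 𝔸}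

lemma mono (hg : PolyControl w m g) (hw : ∀ x, 1 ≤ w x) (hm : m ≤ m') : PolyControl w m' g where
  contDiff := hg.contDiff
  bound k := by
    obtain ⟨C, hC, hb⟩ := hg.bound k
    exact ⟨C, hC, fun x => (hb x).trans
      (mul_le_mul_of_nonneg_left (pow_le_pow_right₀ (hw x) hm) hC)⟩
  vanish k hk := hg.vanish k (hm.trans_lt hk)

lemma add (hg : PolyControl w m g) (hh : PolyControl w m h) :
    PolyControl w m (fun x => g x + h x) := by
  have hadd : ∀ k x, ‖iteratedFDeriv ℝ k (fun x => g x + h x) x‖ ≤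
      ‖iteratedFDeriv ℝ k g x‖ + ‖iteratedFDeriv ℝ k h x‖ := by
    intro k x
    have := iteratedFDeriv_add_apply (x := x) (i := k)
      ((hg.contDiff.of_le (by exact_mod_cast le_top)).contDiffAt)
      ((hh.contDiff.of_le (by exact_mod_cast le_top)).contDiffAt)
    rw [show (fun x => g x + h x) = g + h from rfl, this]
    exact norm_add_le _ _
  refine ⟨hg.contDiff.add hh.contDiff, fun k => ?_, fun k hk x => le_antisymm ?_ (norm_nonneg _)⟩
  · obtain ⟨C, hC, hb⟩ := hg.bound k
    obtain ⟨C', hC', hb'⟩ := hh.bound k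
    refine ⟨C + C', by positivity, fun x => (hadd k x).trans ?_⟩
    rw [add_mul]
    exact add_le_add (hb x) (hb' x)
  · refine (hadd k x).trans ?_
    rw [hg.vanish k hk, hh.vanish k hk, add_zero]

lemma mul (hg : PolyControl w m g) (hh : PolyControl w m' h) :
    PolyControl w (m + m') (fun x => g x * h x) := by
  have hmul := fun (k : ℕ) (x : E) => norm_iteratedFDeriv_mul_le hg.contDiff hh.contDiff x
    (n := k) (by exact_mod_cast le_top)
  refine ⟨hg.contDiff.mul hh.contDiff, fun k => ?_, fun k hk x => le_antisymm ?_ (norm_nonneg _)⟩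
  · choose C hC hb using hg.bound
    choose C' hC' hb' using hh.bound
    refine ⟨∑ i ∈ Finset.range (k + 1), (k.choose i : ℝ) * C i * C' (k - i),
      Finset.sum_nonneg fun i _ => by have := hC i; have := hC' (k - i); positivity,
      fun x => (hmul k x).trans ?_⟩
    rw [Finset.sum_mul]
    refine Finset.sum_le_sum fun i _ => ?_
    have h1 := mul_le_mul (hb i x) (hb' (k - i) x) (norm_nonneg _)
      ((norm_nonneg _).trans (hb i x))
    calc _ = (k.choose i : ℝ) * (‖iteratedFDeriv ℝ i g x‖ * ‖iteratedFDeriv ℝ (k - i) h x‖) := by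
          ring
      _ ≤ (k.choose i : ℝ) * (C i * w x ^ m * (C' (k - i) * w x ^ m')) := by gcongr
      _ = _ := by ring
  · refine (hmul k x).trans (Finset.sum_nonpos fun i _ => le_of_eq ?_)
    by_cases hi : m < i
    · rw [hg.vanish i hi, mul_zero, zero_mul]
    · rw [hh.vanish (k - i) (by omega), mul_zero]

lemma const (c : 𝔸) : PolyControl w 0 (fun _ => c) where
  contDiff := contDiff_const
  bound k := by
    refine ⟨‖c‖, norm_nonneg _, fun x => ?_⟩
    rw [pow_zero, mul_one]
    rcases Nat.eq_zero_or_pos k with rfl | hk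
    · rw [norm_iteratedFDeriv_zero]
    · rw [iteratedFDeriv_const_of_ne hk.ne']
      simp
  vanish k hk x := by
    rw [iteratedFDeriv_const_of_ne hk.ne']
    simp

lemma sum {ι : Type*} (s : Finset ι) {g : ι → E → 𝔸} (hw : ∀ x, 1 ≤ w x)
    (hg : ∀ i ∈ s, PolyControl w m (g i)) : PolyControl w m (fun x => ∑ i ∈ s, g i x) := by
  classical
  induction s using Finset.induction_on with
  | empty => simpa using (const (0 : 𝔸)).mono hw (Nat.zero_le m)
  | insert i s hi ih =>
    simp_rw [Finset.sum_insert hi]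
    exact (hg i (Finset.mem_insert_self _ _)).add
      (ih fun j hj => hg j (Finset.mem_insert_of_mem hj))

lemma pow (hg : PolyControl w 1 g) (i : ℕ) : PolyControl w i (fun x => g x ^ i) := by
  induction i with
  | zero => simpa using const (1 : 𝔸)
  | succ i ih =>
    simp_rw [pow_succ]
    exact ih.mul hg

lemma of_clm (ℓ : E →L[ℝ] 𝔸) (hw : ∀ x, 1 ≤ w x) (hℓ : ∀ x, ‖ℓ x‖ ≤ w x) :
    PolyControl w 1 ℓ := by
  have hsucc : ∀ k x, ‖iteratedFDeriv ℝ (k + 1) ℓ x‖ =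
      ‖iteratedFDeriv ℝ k (fun _ : E => ℓ) x‖ := fun k x => by
    rw [← norm_iteratedFDeriv_fderiv]
    congr 3
    ext1 y
    exact ℓ.fderiv
  refine ⟨ℓ.contDiff, fun k => ?_, fun k hk x => ?_⟩
  · refine ⟨1 + ‖ℓ‖, by positivity, fun x => ?_⟩
    rw [pow_one]
    have h1 := hw x
    have h2 := norm_nonneg ℓ
    rcases k with - | k
    · rw [norm_iteratedFDeriv_zero]
      nlinarith [hℓ x]
    · rw [hsucc]
      rcases Nat.eq_zero_or_pos k with rfl | hk
      · rw [norm_iteratedFDeriv_zero]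
        nlinarith
      · rw [iteratedFDeriv_const_of_ne hk.ne']
        simp only [Pi.zero_apply, norm_zero]
        positivity
  · obtain ⟨j, rfl⟩ : ∃ j, k = j + 1 := ⟨k - 1, by omega⟩
    rw [hsucc, iteratedFDeriv_const_of_ne (by omega)]
    simp

lemma aeval {g : E → ℂ} (hg : PolyControl w 1 g) (hw : ∀ x, 1 ≤ w x) {f : ℝ[X]}
    (hf : f.natDegree ≤ m) : PolyControl w m (fun x => aeval (g x) f) := by
  simp_rw [aeval_eq_sum_range, Algebra.smul_def]
  refine sum _ hw fun i hi => ?_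
  rw [Finset.mem_range] at hi
  simpa using ((const (algebraMap ℝ ℂ (f.coeff i))).mul (hg.pow i)).mono hw (m' := m) (by omega)

lemma re {g : E → ℂ} (hg : PolyControl w m g) : PolyControl w m (fun x => (g x).re) := by
  have h : ∀ k x, ‖iteratedFDeriv ℝ k (fun x => (g x).re) x‖ ≤
      ‖Complex.reCLM‖ * ‖iteratedFDeriv ℝ k g x‖ := fun k x =>
    Complex.reCLM.norm_iteratedFDeriv_comp_left hg.contDiff.contDiffAt
      (by exact_mod_cast le_top)
  refine ⟨Complex.reCLM.contDiff.comp hg.contDiff, fun k => ?_,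
    fun k hk x => le_antisymm ?_ (norm_nonneg _)⟩
  · obtain ⟨C, hC, hb⟩ := hg.bound k
    refine ⟨‖Complex.reCLM‖ * C, by positivity, fun x => (h k x).trans ?_⟩
    rw [mul_assoc]
    exact mul_le_mul_of_nonneg_left (hb x) (norm_nonneg _)
  · refine (h k x).trans ?_
    rw [hg.vanish k hk, mul_zero]

end PolyControl

/-- Uniform `C^l` bounds: on `{|x₁| ≤ L, |(x₂, …, x_d)| ≤ 2}` the `j`-th derivatives of the second
summand are `O(ε L ^ (2 n))`, and they vanish for `j > 2 n`. -/
lemma exists_cNorm_torsionFn_le {d : ℕ} (hd : 2 ≤ d) {n : ℕ} (hn : 0 < n) {f : ℝ[X]}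
    (hf : f.natDegree ≤ 2 * n) :
    ∃ C : ℝ, 0 < C ∧ ∀ ε L : ℝ, 0 < ε → 1 ≤ L → ε * L ^ (2 * n) = 2 * crossCoeff d →
      ∀ Ω : Set (EuclideanSpace ℝ (Fin d)),
        (∀ x ∈ Ω, |x (i₁ hd)| ≤ L ∧ ‖crossProj hd x‖ ≤ 2) →
        ∀ l, cNorm l Ω (torsionFn hd f ε) ≤ ENNReal.ofReal C := by
  set w₁ : EuclideanSpace ℝ (Fin d) → ℝ := fun x => 1 + ‖crossProj hd x‖ with hw₁
  set w₂ : EuclideanSpace ℝ (Fin d) → ℝ := fun x => 1 + ‖planeMap hd x‖ with hw₂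
  have h1w₁ : ∀ x, 1 ≤ w₁ x := fun x => by simp [hw₁]
  have h1w₂ : ∀ x, 1 ≤ w₂ x := fun x => by simp [hw₂]
  have hA := crossCoeff_pos hd
  have hc1 : PolyControl w₁ 2 (fun x => crossCoeff d * (1 - ‖crossProj hd x‖ ^ 2)) := by
    have hsq : PolyControl w₁ 2 (fun x => ‖crossProj hd x‖ ^ 2) := by
      simp_rw [EuclideanSpace.real_norm_sq_eq]
      refine PolyControl.sum _ h1w₁ fun i _ => PolyControl.pow ?_ 2
      refine PolyControl.of_clm ((EuclideanSpace.proj i).comp (crossProj hd)) h1w₁ fun x => ?_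
      have := PiLp.norm_apply_le (crossProj hd x) i
      simp only [ContinuousLinearMap.comp_apply, hw₁]
      exact this.trans (by linarith)
    have h := ((PolyControl.const (w := w₁) (1 : ℝ)).mono h1w₁ (Nat.zero_le 2)).add
      (((PolyControl.const (w := w₁) (-1 : ℝ)).mul hsq).mono h1w₁ (m' := 2) (by omega))
    have h' := ((PolyControl.const (w := w₁) (crossCoeff d)).mul h).mono h1w₁ (m' := 2) (by omega)
    convert h' using 2
    ring
  have hc2 : PolyControl w₂ (2 * n) (fun x => (aeval (planeMap hd x) f).re) :=
    (PolyControl.aeval (PolyControl.of_clm (planeMap hd) h1w₂ fun x => by simp [hw₂]) h1w₂ hf).re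
  choose C₁ hC₁ hb₁ using hc1.bound
  choose C₂ hC₂ hb₂ using hc2.bound
  set B : ℕ → ℝ := fun k => C₁ k * 3 ^ 2 + C₂ k * 4 ^ (2 * n) * (2 * crossCoeff d) with hB
  have hB0 : ∀ k, 0 ≤ B k := fun k => by have := hC₁ k; have := hC₂ k; positivity
  refine ⟨∑ k ∈ Finset.range (2 * n + 1), B k + 1,
    add_pos_of_nonneg_of_pos (Finset.sum_nonneg fun k _ => hB0 k) one_pos, ?_⟩
  intro ε L hε hL hεL Ω hΩ l
  have hsplit : ∀ k x, ‖iteratedFDeriv ℝ k (torsionFn hd f ε) x‖ ≤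
      ‖iteratedFDeriv ℝ k (fun x => crossCoeff d * (1 - ‖crossProj hd x‖ ^ 2)) x‖ +
        ε * ‖iteratedFDeriv ℝ k (fun x => (aeval (planeMap hd x) f).re) x‖ := by
    intro k x
    have hs1 : ContDiffAt ℝ k (fun x => crossCoeff d * (1 - ‖crossProj hd x‖ ^ 2)) x :=
      (hc1.contDiff.of_le (by exact_mod_cast le_top)).contDiffAt
    have hs2 : ContDiffAt ℝ k (fun x => (aeval (planeMap hd x) f).re) x :=
      (hc2.contDiff.of_le (by exact_mod_cast le_top)).contDiffAt
    have heq : torsionFn hd f ε = (fun x => crossCoeff d * (1 - ‖crossProj hd x‖ ^ 2)) +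
      ε • (fun x => (aeval (planeMap hd x) f).re) := rfl
    have hs3 : ContDiffAt ℝ k (ε • fun x => (aeval (planeMap hd x) f).re) x := hs2.const_smul ε
    rw [heq, iteratedFDeriv_add_apply hs1 hs3, iteratedFDeriv_const_smul_apply hs2]
    refine (norm_add_le _ _).trans ?_
    rw [norm_smul, Real.norm_of_nonneg hε.le]
  have hbound : ∀ k, ∀ x ∈ Ω, ‖iteratedFDeriv ℝ k (torsionFn hd f ε) x‖ ≤
      if k ≤ 2 * n then B k else 0 := by
    intro k x hx
    obtain ⟨hx1, hx2⟩ := hΩ x hx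
    refine (hsplit k x).trans ?_
    split_ifs with hk
    · refine add_le_add ((hb₁ k x).trans ?_) ?_
      · have := hC₁ k
        have : w₁ x ≤ 3 := by simp only [hw₁]; linarith
        gcongr
      · have hw : w₂ x ≤ 4 * L := by
          have h := Complex.norm_le_abs_re_add_abs_im (planeMap hd x)
          rw [planeMap_re, planeMap_im] at h
          have := abs_i₂_le hd x
          simp only [hw₂]
          linarith
        have hw0 : 0 ≤ w₂ x := zero_le_one.trans (h1w₂ x)
        calc ε * _ ≤ ε * (C₂ k * w₂ x ^ (2 * n)) := by gcongr; exact hb₂ k x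
          _ ≤ ε * (C₂ k * (4 * L) ^ (2 * n)) := by have := hC₂ k; gcongr
          _ = C₂ k * 4 ^ (2 * n) * (ε * L ^ (2 * n)) := by rw [mul_pow]; ring
          _ = _ := by rw [hεL]
    · rw [hc1.vanish k (by omega), hc2.vanish k (by omega)]
      simp
  unfold cNorm
  calc ∑ k ∈ Finset.range (l + 1), ⨆ x ∈ Ω, ‖iteratedFDeriv ℝ k (torsionFn hd f ε) x‖ₑ
      ≤ ∑ k ∈ Finset.range (l + 1), ENNReal.ofReal (if k ≤ 2 * n then B k else 0) := by
        refine Finset.sum_le_sum fun k _ => iSup₂_le fun x hx => ?_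
        rw [← ofReal_norm]
        exact ENNReal.ofReal_le_ofReal (hbound k x hx)
    _ = ENNReal.ofReal (∑ k ∈ Finset.range (l + 1), if k ≤ 2 * n then B k else 0) := by
        rw [ENNReal.ofReal_sum_of_nonneg]
        intro k _
        split_ifs
        · exact hB0 k
        · exact le_rfl
    _ ≤ _ := by
        refine ENNReal.ofReal_le_ofReal ?_
        rw [← Finset.sum_filter]
        refine (Finset.sum_le_sum_of_subset_of_nonneg (t := Finset.range (2 * n + 1)) ?_
          fun k _ _ => hB0 k).trans (by linarith)
        intro k hk
        rw [Finset.mem_filter] at hk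
        exact Finset.mem_range.2 (by omega)

/-! ### The maximum principle and uniqueness -/

/-- Second-order necessary condition at a local maximum. -/
lemma iteratedFDeriv_two_nonpos_of_isLocalMax {E : Type*} [NormedAddCommGroup E] [NormedSpace ℝ E]
    {g : E → ℝ} {x : E} (hg : ContDiffAt ℝ 2 g x) (hx : IsLocalMax g x) (e : E) :
    iteratedFDeriv ℝ 2 g x ![e, e] ≤ 0 := by
  rw [iteratedFDeriv_two_apply]
  by_contra! hpos
  set γ : ℝ → E := fun t => x + t • e with hγ
  have hγd : ∀ t, HasDerivAt γ e t := fun t => by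
    have := ((hasDerivAt_id t).smul_const e).const_add x
    rwa [one_smul] at this
  have hγ0 : γ 0 = x := by simp [hγ]
  have hγc : Tendsto γ (𝓝 0) (𝓝 x) := by
    have := (hγd 0).continuousAt.tendsto
    rwa [hγ0] at this
  have hd1 : deriv (g ∘ γ) =ᶠ[𝓝 0] fun t => fderiv ℝ g (γ t) e := by
    have h1 : ∀ᶠ y in 𝓝 x, DifferentiableAt ℝ g y := by
      filter_upwards [hg.eventually (by simp)] with y hy
      exact hy.differentiableAt (by norm_num)
    filter_upwards [hγc.eventually h1] with t ht
    exact (ht.hasFDerivAt.comp_hasDerivAt t (hγd t)).deriv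
  have hdiff : DifferentiableAt ℝ (fderiv ℝ g) (γ 0) := by
    rw [hγ0]
    exact (hg.fderiv_right (m := 1) le_rfl).differentiableAt one_ne_zero
  have hd2 : deriv (deriv (g ∘ γ)) 0 = fderiv ℝ (fderiv ℝ g) x e e := by
    rw [hd1.deriv_eq]
    have := (hdiff.hasFDerivAt.comp_hasDerivAt (0 : ℝ) (hγd 0)).clm_apply
      (hasDerivAt_const (0 : ℝ) e)
    have h' := this.deriv
    simp only [Function.comp_apply, map_zero, add_zero, hγ0] at h'
    exact h'
  have hmax : IsLocalMax (g ∘ γ) 0 := by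
    have : ∀ᶠ y in 𝓝 x, g y ≤ g x := hx
    filter_upwards [hγc.eventually this] with t ht
    simpa [hγ0] using ht
  have hcont : ContinuousAt (g ∘ γ) 0 := by
    refine ContinuousAt.comp ?_ (hγd 0).continuousAt
    rw [hγ0]
    exact hg.continuousAt
  have hpos' : 0 < deriv (deriv (g ∘ γ)) 0 := hd2 ▸ hpos
  have hmin : IsLocalMin (g ∘ γ) 0 :=
    isLocalMin_of_deriv_deriv_pos hpos' hmax.deriv_eq_zero hcont
  have hconst : g ∘ γ =ᶠ[𝓝 0] fun _ => (g ∘ γ) 0 := by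
    filter_upwards [hmax, hmin] with t h1 h2 using le_antisymm h1 h2
  have hd0 : deriv (g ∘ γ) =ᶠ[𝓝 0] fun _ => 0 := by
    refine hconst.deriv.trans (Eventually.of_forall fun t => ?_)
    simp
  rw [hd0.deriv_eq] at hpos'
  simp at hpos'

/-- The weak maximum principle for subharmonic functions on a bounded open set. -/
lemma nonpos_of_laplacian_nonneg {d : ℕ} {Ω : Set (EuclideanSpace ℝ (Fin d))} (hd : 0 < d)
    (ho : IsOpen Ω) (hb : Bornology.IsBounded Ω) {h : EuclideanSpace ℝ (Fin d) → ℝ}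
    (hC : ContDiffOn ℝ 2 h Ω) (hc : ContinuousOn h (closure Ω))
    (hΔ : ∀ x ∈ Ω, 0 ≤ Laplacian.laplacian h x) (hbd : ∀ x ∈ frontier Ω, h x ≤ 0) :
    ∀ x ∈ closure Ω, h x ≤ 0 := by
  obtain ⟨R, hR⟩ := hb.closure.exists_norm_le
  have hcomp : IsCompact (closure Ω) := hb.isCompact_closure
  -- perturb `h` to the strictly subharmonic function `h + δ |x|²`
  have key : ∀ δ : ℝ, 0 < δ → ∀ x ∈ closure Ω, h x + δ * ‖x‖ ^ 2 ≤ δ * R ^ 2 := by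
    intro δ hδ x hx
    set q : EuclideanSpace ℝ (Fin d) → ℝ := δ • fun y => ‖y‖ ^ 2 with hq
    have hqs : ContDiff ℝ 2 q := (contDiff_norm_sq ℝ).const_smul δ
    have hR0 : ∀ y ∈ closure Ω, δ * ‖y‖ ^ 2 ≤ δ * R ^ 2 := fun y hy => by
      have := hR y hy
      gcongr
    obtain ⟨p, hp, hpm⟩ := hcomp.exists_isMaxOn ⟨x, hx⟩ (f := h + q)
      (hc.add hqs.continuous.continuousOn)
    refine (hpm hx : (h + q) x ≤ (h + q) p).trans ?_
    by_cases hpΩ : p ∈ Ω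
    · exfalso
      have hhp : ContDiffAt ℝ 2 h p := hC.contDiffAt (ho.mem_nhds hpΩ)
      have hloc : IsLocalMax (h + q) p := by
        filter_upwards [ho.mem_nhds hpΩ] with y hy using hpm (subset_closure hy)
      have hle : Laplacian.laplacian (h + q) p ≤ 0 := by
        rw [InnerProductSpace.laplacian_eq_iteratedFDeriv_stdOrthonormalBasis]
        exact Finset.sum_nonpos fun i _ =>
          iteratedFDeriv_two_nonpos_of_isLocalMax (hhp.add hqs.contDiffAt) hloc _
      have hΔq : Laplacian.laplacian q p = 2 * δ * d := by
        have hD : ∀ y, HasFDerivAt q ((2 * δ) • innerSL ℝ y) y := fun y => by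
          have := ((hasFDerivAt_id (𝕜 := ℝ) y).norm_sq).const_smul δ
          refine this.congr_fderiv ?_
          ext z
          simp
          ring
        have hfd : fderiv ℝ q = fun y => (2 * δ) • innerSL ℝ y := funext fun y => (hD y).fderiv
        have hfd2 : fderiv ℝ (fderiv ℝ q) p = (2 * δ) • innerSL ℝ := by
          rw [hfd]
          exact (((innerSL ℝ).hasFDerivAt (x := p)).const_smul (2 * δ)).fderiv
        have hee : ∀ e, iteratedFDeriv ℝ 2 q p ![e, e] = 2 * δ * ‖e‖ ^ 2 := fun e => by
          rw [iteratedFDeriv_two_apply, hfd2, ← real_inner_self_eq_norm_sq]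
          rfl
        rw [InnerProductSpace.laplacian_eq_iteratedFDeriv_orthonormalBasis _
          (EuclideanSpace.basisFun (Fin d) ℝ)]
        simp [hee]
        ring
      rw [hhp.laplacian_add hqs.contDiffAt, hΔq] at hle
      have := hΔ p hpΩ
      have : (0 : ℝ) < d := by exact_mod_cast hd
      have : 0 < 2 * δ * d := by positivity
      linarith
    · have : p ∈ frontier Ω := by
        rw [ho.frontier_eq]
        exact ⟨hp, hpΩ⟩
      have h1 := hbd p this
      have h2 := hR0 p hp
      calc (h + q) p = h p + δ * ‖p‖ ^ 2 := rfl
        _ ≤ _ := by linarith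
  intro x hx
  have hlim : Tendsto (fun δ : ℝ => δ * R ^ 2) (𝓝[>] 0) (𝓝 0) := by
    have : Tendsto (fun δ : ℝ => δ * R ^ 2) (𝓝 0) (𝓝 (0 * R ^ 2)) :=
      (continuous_id.mul continuous_const).tendsto 0
    rw [zero_mul] at this
    exact this.mono_left nhdsWithin_le_nhds
  refine ge_of_tendsto hlim ?_
  filter_upwards [self_mem_nhdsWithin] with δ hδ
  have hδ' : (0 : ℝ) < δ := hδ
  have := key δ hδ x hx
  have : 0 ≤ δ * ‖x‖ ^ 2 := by positivity
  linarith

/-- Uniqueness for the torsion problem on a bounded open set. -/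
lemma IsTorsionSolution.eqOn {d : ℕ} (hd : 0 < d) {Ω : Set (EuclideanSpace ℝ (Fin d))}
    (ho : IsOpen Ω) (hb : Bornology.IsBounded Ω) {w₁ w₂ : EuclideanSpace ℝ (Fin d) → ℝ}
    (h₁ : IsTorsionSolution Ω w₁) (h₂ : IsTorsionSolution Ω w₂) : EqOn w₁ w₂ (closure Ω) := by
  have key : ∀ w w' : EuclideanSpace ℝ (Fin d) → ℝ, IsTorsionSolution Ω w →
      IsTorsionSolution Ω w' → ∀ x ∈ closure Ω, (w - w') x ≤ 0 := by
    intro w w' hw hw'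
    refine nonpos_of_laplacian_nonneg hd ho hb (hw.contDiffOn.sub hw'.contDiffOn)
      (hw.continuousOn.sub hw'.continuousOn) (fun x hx => ?_) fun x hx => ?_
    · have hx' := ho.mem_nhds hx
      rw [(hw.contDiffOn.contDiffAt hx').laplacian_sub (hw'.contDiffOn.contDiffAt hx')]
      have := hw.equation x hx
      have := hw'.equation x hx
      linarith
    · rw [Pi.sub_apply, hw.boundary x hx, hw'.boundary x hx, sub_zero]
  intro x hx
  have h1 := key w₁ w₂ h₁ h₂ x hx
  have h2 := key w₂ w₁ h₂ h₁ x hx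
  simp only [Pi.sub_apply] at h1 h2
  linarith

/-! ### The domain and its star-shapedness -/

/-- The smallness conditions on `ε`, where `L` is the half-length of the domain up to a constant
factor, and `ρ` is the distance to the lateral boundary from which on all points are seen from
every point of the domain. -/
structure SmallParam (d n : ℕ) (M K ε L ρ : ℝ) : Prop where
  eps_pos : 0 < ε
  one_le : 1 ≤ L
  M_le : M ≤ L
  eps_mul_pow : ε * L ^ (2 * n) = 2 * crossCoeff d
  eps_mul_K : ε * K < crossCoeff d / 4
  eps_mul_hess : ε * (K * (1 + L) ^ (2 * n - 2)) ≤ crossCoeff d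
  rho_mul : crossCoeff d * ρ = 4 * K * ε * (M + L + 4)
  rho_le : ρ ≤ 1

/-- The convex set `{|(x₂, …, x_d)|² < 2}`. -/
def slab {d : ℕ} (hd : 2 ≤ d) : Set (EuclideanSpace ℝ (Fin d)) := {x | ‖crossProj hd x‖ ^ 2 < 2}

section

variable {d : ℕ} (hd : 2 ≤ d)

lemma convex_slab : Convex ℝ (slab hd) := by
  have : slab hd = (crossProj hd).toLinearMap ⁻¹' Metric.ball 0 (Real.sqrt 2) := by
    ext x
    rw [mem_preimage, mem_ball_zero_iff, Real.lt_sqrt (norm_nonneg _)]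
    rfl
  rw [this]
  exact (convex_ball _ _).linear_preimage _

lemma isOpen_slab : IsOpen (slab hd) :=
  isOpen_lt ((crossProj hd).continuous.norm.pow 2) continuous_const

lemma abs_i₂_le_two {x : EuclideanSpace ℝ (Fin d)} (hx : ‖crossProj hd x‖ ^ 2 ≤ 2) :
    |x (i₂ hd)| ≤ 2 :=
  (abs_i₂_le hd x).trans (by nlinarith [norm_nonneg (crossProj hd x)])

lemma hasDerivAt_torsionFn_line (f : ℝ[X]) (ε : ℝ) (x h : EuclideanSpace ℝ (Fin d)) (t : ℝ) :
    HasDerivAt (fun t : ℝ => torsionFn hd f ε (x + t • h))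
      (dTorsionFn hd f ε (x + t • h) h) t := by
  have := ((hasDerivAt_id t).smul_const h).const_add x
  rw [one_smul] at this
  exact (hasFDerivAt_torsionFn hd f ε (x + t • h)).comp_hasDerivAt t this

lemma hasDerivAt_dTorsionFn_line (f : ℝ[X]) (ε : ℝ) (x h : EuclideanSpace ℝ (Fin d)) (t : ℝ) :
    HasDerivAt (fun t : ℝ => dTorsionFn hd f ε (x + t • h) h)
      (hessTorsionFn hd f ε (x + t • h) h h) t := by
  have := ((hasDerivAt_id t).smul_const h).const_add x
  rw [one_smul] at this
  obtain ⟨D, hD, hD'⟩ := hasFDerivAt_dTorsionFn_apply hd f ε (x + t • h) h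
  rw [← hD]
  exact HasFDerivAt.comp_hasDerivAt (l := fun y => dTorsionFn hd f ε y h) t hD' this

end

section

variable {d : ℕ} (hd : 2 ≤ d) {n : ℕ} {f : ℝ[X]} {M K ε L ρ : ℝ}

lemma StripBounds.re_le_K (hf : StripBounds n f M K) {z : ℂ} (hz : |z.im| ≤ 2) :
    (aeval z f).re ≤ K := by
  rcases le_total |z.re| M with h | h
  · exact (Complex.re_le_norm _).trans (hf.norm_le z hz h)
  · have h1 := hf.re_le z hz h
    have h2 : 0 ≤ z.re ^ (2 * n) := (even_two_mul n).pow_nonneg _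
    linarith [hf.K_pos]

lemma torsionFn_le (hf : StripBounds n f M K) (hε : 0 ≤ ε) {x : EuclideanSpace ℝ (Fin d)}
    (hx : ‖crossProj hd x‖ ^ 2 ≤ 2) :
    torsionFn hd f ε x ≤ crossCoeff d * (1 - ‖crossProj hd x‖ ^ 2) + ε * K := by
  have := hf.re_le_K (z := planeMap hd x) (by rw [planeMap_im]; exact abs_i₂_le_two hd hx)
  unfold torsionFn
  gcongr

lemma torsionFn_ge (hf : StripBounds n f M K) (hε : 0 ≤ ε) {x : EuclideanSpace ℝ (Fin d)}
    (hx : ‖crossProj hd x‖ ^ 2 ≤ 2) (hs : |x (i₁ hd)| ≤ M) :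
    crossCoeff d * (1 - ‖crossProj hd x‖ ^ 2) - ε * K ≤ torsionFn hd f ε x := by
  have := hf.norm_le (planeMap hd x) (by rw [planeMap_im]; exact abs_i₂_le_two hd hx)
    (by rwa [planeMap_re])
  have := (abs_le.1 ((Complex.abs_re_le_norm _).trans this)).1
  unfold torsionFn
  nlinarith

lemma torsionFn_neg_of_sq_eq_two (hf : StripBounds n f M K) (hp : SmallParam d n M K ε L ρ)
    {x : EuclideanSpace ℝ (Fin d)} (hx : ‖crossProj hd x‖ ^ 2 = 2) : torsionFn hd f ε x < 0 := by
  have h := torsionFn_le hd hf hp.eps_pos.le hx.le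
  have := hp.eps_mul_K
  have := crossCoeff_pos hd
  rw [hx] at h
  linarith

lemma torsionFn_neg_of_le_abs (hf : StripBounds n f M K) (hp : SmallParam d n M K ε L ρ)
    {x : EuclideanSpace ℝ (Fin d)} (hx : ‖crossProj hd x‖ ^ 2 ≤ 2) (hs : L ≤ |x (i₁ hd)|) :
    torsionFn hd f ε x < 0 := by
  have h := hf.re_le (planeMap hd x) (by rw [planeMap_im]; exact abs_i₂_le_two hd hx)
    (by rw [planeMap_re]; exact hp.M_le.trans hs)
  rw [planeMap_re] at h
  have h1 : L ^ (2 * n) ≤ x (i₁ hd) ^ (2 * n) := by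
    rw [← (even_two_mul n).pow_abs (x (i₁ hd))]
    exact pow_le_pow_left₀ (zero_le_one.trans hp.one_le) hs _
  have hε := hp.eps_pos
  have h2 : ε * (aeval (planeMap hd x) f).re ≤ -(3 / 4) * (2 * crossCoeff d) := by
    rw [← hp.eps_mul_pow]
    calc ε * (aeval (planeMap hd x) f).re ≤ ε * (-(3 / 4) * x (i₁ hd) ^ (2 * n)) := by gcongr
      _ ≤ ε * (-(3 / 4) * L ^ (2 * n)) := mul_le_mul_of_nonneg_left (by linarith) hε.le
      _ = _ := by ring
  have hA := crossCoeff_pos hd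
  have h3 : crossCoeff d * (1 - ‖crossProj hd x‖ ^ 2) ≤ crossCoeff d := by
    nlinarith [sq_nonneg ‖crossProj hd x‖]
  unfold torsionFn
  linarith

lemma abs_lt_of_torsionFn_nonneg (hf : StripBounds n f M K) (hp : SmallParam d n M K ε L ρ)
    {x : EuclideanSpace ℝ (Fin d)} (hx : ‖crossProj hd x‖ ^ 2 ≤ 2) (hu : 0 ≤ torsionFn hd f ε x) :
    |x (i₁ hd)| < L := by
  by_contra! h
  exact (torsionFn_neg_of_le_abs hd hf hp hx h).not_ge hu

/-- The second differential is nonpositive in the ends `M ≤ |x₁| ≤ L` of the domain: there `f''`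
is close to a negative real number of size at most `crossCoeff d / ε`. -/
lemma hessTorsionFn_nonpos (hf : StripBounds n f M K) (hp : SmallParam d n M K ε L ρ)
    {x : EuclideanSpace ℝ (Fin d)} (hx : ‖crossProj hd x‖ ^ 2 ≤ 2) (hM : M ≤ |x (i₁ hd)|)
    (hL : |x (i₁ hd)| ≤ L) (h : EuclideanSpace ℝ (Fin d)) :
    hessTorsionFn hd f ε x h h ≤ 0 := by
  have him : |(planeMap hd x).im| ≤ 2 := by rw [planeMap_im]; exact abs_i₂_le_two hd hx
  have h1 := hf.abs_im_le (planeMap hd x) him (by rwa [planeMap_re])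
  have h2 := hf.norm_derivative2_le (planeMap hd x) him
  rw [planeMap_re] at h2
  have hε := hp.eps_pos
  have hK := hf.K_pos
  set w := aeval (planeMap hd x) f.derivative.derivative with hw
  have h3 : ε * (-w.re) ≤ crossCoeff d := by
    refine le_trans ?_ hp.eps_mul_hess
    have h4 : -w.re ≤ K * (1 + L) ^ (2 * n - 2) := by
      refine ((neg_le_abs _).trans (Complex.abs_re_le_norm w)).trans (h2.trans ?_)
      gcongr
    exact mul_le_mul_of_nonneg_left h4 hε.le
  have hb : h (i₂ hd) ^ 2 ≤ ‖crossProj hd h‖ ^ 2 := by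
    rw [← sq_abs]
    exact pow_le_pow_left₀ (abs_nonneg _) (abs_i₂_le hd h) 2
  have hre : (w * planeMap hd h * planeMap hd h).re ≤ -2 * w.re * h (i₂ hd) ^ 2 := by
    simp only [Complex.mul_re, Complex.mul_im, planeMap_re, planeMap_im]
    set a := h (i₁ hd)
    set b := h (i₂ hd)
    have h5 : -(2 * w.im * a * b) ≤ -w.re * (a ^ 2 + b ^ 2) := by
      have h6 : |2 * w.im * a * b| ≤ -w.re * (a ^ 2 + b ^ 2) := by
        have : |2 * w.im * a * b| = |w.im| * (2 * |a| * |b|) := by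
          simp only [abs_mul, abs_two]; ring
        rw [this]
        refine mul_le_mul h1 ?_ (by positivity) ((abs_nonneg _).trans h1)
        rw [← sq_abs a, ← sq_abs b]
        exact two_mul_le_add_sq _ _
      exact (neg_le_abs _).trans h6
    linarith
  rw [hessTorsionFn, real_inner_self_eq_norm_sq]
  have h7 := mul_le_mul_of_nonneg_left hre hε.le
  have h8 : ε * (-w.re) * h (i₂ hd) ^ 2 ≤ crossCoeff d * ‖crossProj hd h‖ ^ 2 :=
    mul_le_mul h3 hb (sq_nonneg _) (crossCoeff_pos hd).le
  linarith

/-- Concavity of `torsionFn` in each of the two ends `M ≤ σ x₁ ≤ L`, `σ = ± 1`. -/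
lemma torsionFn_le_tangent (hf : StripBounds n f M K) (hp : SmallParam d n M K ε L ρ)
    {σ : ℝ} (hσ : |σ| = 1) {x x' : EuclideanSpace ℝ (Fin d)} (hx : x ∈ slab hd)
    (hx' : x' ∈ slab hd) (hM : M ≤ σ * x (i₁ hd)) (hM' : M ≤ σ * x' (i₁ hd))
    (hL : σ * x (i₁ hd) ≤ L) (hL' : σ * x' (i₁ hd) ≤ L) :
    torsionFn hd f ε x' ≤ torsionFn hd f ε x + dTorsionFn hd f ε x (x' - x) := by
  set h := x' - x with hh
  have hneg : ∀ t ∈ Icc (0 : ℝ) 1, hessTorsionFn hd f ε (x + t • h) h h ≤ 0 := by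
    intro t ht
    have hs : x + t • h ∈ slab hd := (convex_slab hd).add_smul_sub_mem hx hx' ht
    have hcoord : σ * (x + t • h) (i₁ hd) =
        (1 - t) * (σ * x (i₁ hd)) + t * (σ * x' (i₁ hd)) := by
      simp [hh]; ring
    have h0 := ht.1
    have h1 : 0 ≤ 1 - t := sub_nonneg.2 ht.2
    have hge : M ≤ σ * (x + t • h) (i₁ hd) := by rw [hcoord]; nlinarith
    have hle : σ * (x + t • h) (i₁ hd) ≤ L := by rw [hcoord]; nlinarith
    have habs : |(x + t • h) (i₁ hd)| = σ * (x + t • h) (i₁ hd) := by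
      rw [← abs_of_nonneg (hf.M_pos.le.trans hge), abs_mul, hσ, one_mul]
    exact hessTorsionFn_nonpos hd hf hp (le_of_lt hs) (habs ▸ hge) (habs ▸ hle) h
  have hφ := hasDerivAt_torsionFn_line hd f ε x h
  have hφ' := hasDerivAt_dTorsionFn_line hd f ε x h
  obtain ⟨ξ, hξ, he⟩ := exists_hasDerivAt_eq_slope (fun t : ℝ => torsionFn hd f ε (x + t • h)) _
    one_pos (fun t _ => (hφ t).continuousAt.continuousWithinAt) (fun t _ => hφ t)
  obtain ⟨η, hη, he'⟩ := exists_hasDerivAt_eq_slope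
    (fun t : ℝ => dTorsionFn hd f ε (x + t • h) h) _
    hξ.1 (fun t _ => (hφ' t).continuousAt.continuousWithinAt) (fun t _ => hφ' t)
  have hle := hneg η ⟨hη.1.le, (hη.2.trans hξ.2).le⟩
  rw [he', sub_zero, div_nonpos_iff] at hle
  have hξ0 := hξ.1
  simp only [zero_smul, add_zero, one_smul, sub_zero, div_one] at he hle
  have hx'' : x + h = x' := by simp [hh]
  rw [hx''] at he
  rcases hle with hle | hle
  · linarith
  · linarith

/-- The radial derivative from `x₀` is negative wherever `u ≤ 0`, if `x₀` keeps the distance `ρ`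
from the lateral boundary. Near the middle the quadratic part dominates; in the ends concavity is
used, after moving `x₀` along the axis into the end. -/
lemma dTorsionFn_sub_neg (hf : StripBounds n f M K) (hp : SmallParam d n M K ε L ρ)
    {x₀ x : EuclideanSpace ℝ (Fin d)} (hx₀ : ‖crossProj hd x₀‖ ≤ 1 - ρ)
    (hu₀ : 0 < torsionFn hd f ε x₀) (hx : x ∈ slab hd) (hL : |x (i₁ hd)| ≤ L)
    (hu : torsionFn hd f ε x ≤ 0) : dTorsionFn hd f ε x (x - x₀) < 0 := by
  have hA := crossCoeff_pos hd
  have hε := hp.eps_pos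
  have hK := hf.K_pos
  have hM := hf.M_pos
  have hL1 := hp.one_le
  have hεK := hp.eps_mul_K
  have hρ := hp.rho_mul
  have hεK0 : 0 < ε * K := by positivity
  have hρ1 : 4 * (ε * K) ≤ crossCoeff d * ρ := by rw [hρ]; nlinarith
  have hρ0 : 0 < ρ := pos_of_mul_pos_right (by linarith) hA.le
  have hr₀ := norm_nonneg (crossProj hd x₀)
  have hslab₀ : ‖crossProj hd x₀‖ ^ 2 ≤ 1 := by nlinarith
  have hx₀s : x₀ ∈ slab hd := show ‖crossProj hd x₀‖ ^ 2 < 2 by linarith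
  have hL₀ := abs_lt_of_torsionFn_nonneg hd hf hp (le_of_lt hx₀s) hu₀.le
  have him : |(planeMap hd x).im| ≤ 2 := by rw [planeMap_im]; exact abs_i₂_le_two hd (le_of_lt hx)
  rcases le_or_gt |x (i₁ hd)| M with hs | hs
  · have hge := torsionFn_ge hd hf hε.le (le_of_lt hx) hs
    set r := ‖crossProj hd x‖ with hr
    set r₀ := ‖crossProj hd x₀‖ with hr₀'
    have hr0 : 0 ≤ r := norm_nonneg _
    have hr1 : crossCoeff d * (1 - r ^ 2) ≤ ε * K := by linarith
    have hr2 : 1 / 2 ≤ r := by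
      by_contra! hlt
      have hsq : r ^ 2 ≤ 1 / 4 := by nlinarith
      have := mul_le_mul_of_nonneg_left (sub_le_sub_left hsq 1) hA.le
      linarith
    have hr3 : crossCoeff d * (1 - r) ≤ ε * K := by
      rcases le_total r 1 with h1 | h1
      · refine le_trans (mul_le_mul_of_nonneg_left ?_ hA.le) hr1
        nlinarith
      · nlinarith
    have hr4 : crossCoeff d * ρ / 2 ≤ crossCoeff d * (r - r₀) := by nlinarith
    have hinner : r * (r - r₀) ≤ inner ℝ (crossProj hd x) (crossProj hd (x - x₀)) := by
      rw [map_sub, inner_sub_right, real_inner_self_eq_norm_sq]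
      have := real_inner_le_norm (crossProj hd x) (crossProj hd x₀)
      rw [← hr, ← hr₀'] at *
      nlinarith
    have hF := hf.norm_derivative_le (planeMap hd x) him (by rwa [planeMap_re])
    have hz : ‖planeMap hd (x - x₀)‖ < M + L + 4 := by
      have h1 := Complex.norm_le_abs_re_add_abs_im (planeMap hd (x - x₀))
      rw [planeMap_re, planeMap_im, PiLp.sub_apply, PiLp.sub_apply] at h1
      have h2 := abs_sub (x (i₁ hd)) (x₀ (i₁ hd))
      have h3 := abs_sub (x (i₂ hd)) (x₀ (i₂ hd))
      have h4 := abs_i₂_le_two hd (le_of_lt hx)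
      have h5 := abs_i₂_le_two hd (le_of_lt hx₀s)
      linarith
    have hre : (aeval (planeMap hd x) f.derivative * planeMap hd (x - x₀)).re <
        K * (M + L + 4) := by
      refine (Complex.re_le_norm _).trans_lt ?_
      rw [norm_mul]
      exact mul_lt_mul' hF hz (norm_nonneg _) hK
    rw [dTorsionFn_apply]
    have h1 := mul_lt_mul_of_pos_left hre hε
    have h2 := mul_le_mul_of_nonneg_left hinner hA.le
    have h3 : crossCoeff d * ρ / 4 ≤ crossCoeff d * (r * (r - r₀)) := by nlinarith
    nlinarith
  · -- `σ` is the sign of `x₁`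
    obtain ⟨σ, hσ, hσx⟩ : ∃ σ : ℝ, |σ| = 1 ∧ |x (i₁ hd)| = σ * x (i₁ hd) := by
      rcases abs_choice (x (i₁ hd)) with h | h
      · exact ⟨1, by simp, by rw [h, one_mul]⟩
      · exact ⟨-1, by simp, by rw [h]; ring⟩
    have hσ2 : σ * σ = 1 := by
      have := abs_mul_abs_self σ
      rw [hσ] at this
      linarith
    rw [hσx] at hL hs
    have hσ₀ : σ * x₀ (i₁ hd) < L := by
      refine (le_abs_self _).trans_lt ?_
      rwa [abs_mul, hσ, one_mul]
    rcases le_total M (σ * x₀ (i₁ hd)) with hs₀ | hs₀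
    · have h1 := torsionFn_le_tangent hd hf hp hσ hx hx₀s hs.le hs₀ hL hσ₀.le
      rw [← neg_sub x x₀, map_neg] at h1
      linarith
    · set y := axisPt hd (σ * M) + crossProj hd x₀ with hy
      have hy1 : σ * y (i₁ hd) = M := by simp [hy, ← mul_assoc, hσ2]
      have hyP : crossProj hd y = crossProj hd x₀ := by simp [hy]
      have hys : y ∈ slab hd := by rw [slab, mem_ofPred_eq, hyP]; exact hx₀s
      have hyM : |y (i₁ hd)| ≤ M := by
        rw [← hy1, ← one_mul |y (i₁ hd)|, ← hσ, ← abs_mul, hy1, abs_of_pos hM]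
      have huy : 0 < torsionFn hd f ε y := by
        have h1 := torsionFn_ge hd hf hε.le (le_of_lt hys) hyM
        rw [hyP] at h1
        have h2 : ρ ≤ 1 - ‖crossProj hd x₀‖ ^ 2 := by nlinarith
        have h3 := mul_le_mul_of_nonneg_left h2 hA.le
        linarith
      have h1 := torsionFn_le_tangent hd hf hp hσ hx hys hs.le hy1.ge hL (hy1.trans_le hp.M_le)
      have h2 : dTorsionFn hd f ε x (y - x₀) ≤ 0 := by
        have hP : crossProj hd (y - x₀) = 0 := by rw [map_sub, hyP, sub_self]
        have hZ : planeMap hd (y - x₀) = ((σ * M - x₀ (i₁ hd) : ℝ) : ℂ) := by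
          apply Complex.ext <;> simp [hy]
        rw [dTorsionFn_apply, hP, inner_zero_right, mul_zero, zero_add, hZ, Complex.re_mul_ofReal]
        have h3 := hf.re_mul_derivative_neg (planeMap hd x) him
          (by rw [planeMap_re, hσx]; exact hs.le)
        rw [planeMap_re] at h3
        refine mul_nonpos_of_nonneg_of_nonpos hε.le ?_
        set g := (aeval (planeMap hd x) f.derivative).re
        have h4 : σ * g < 0 := by
          have h5 : (σ * x (i₁ hd)) * (σ * g) < 0 := by
            calc _ = (σ * σ) * (x (i₁ hd) * g) := by ring
              _ < 0 := by rw [hσ2, one_mul]; exact h3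
          exact neg_of_mul_neg_right h5 (hM.trans hs).le
        calc g * (σ * M - x₀ (i₁ hd))
            = (σ * g) * (M - σ * x₀ (i₁ hd)) - (σ * σ - 1) * g * (-x₀ (i₁ hd)) := by ring
          _ = (σ * g) * (M - σ * x₀ (i₁ hd)) := by rw [hσ2]; ring
          _ ≤ 0 := mul_nonpos_of_nonpos_of_nonneg h4.le (by linarith)
      have h3 : x - x₀ = (y - x₀) - (y - x) := by abel
      rw [h3, map_sub]
      linarith

/-- Segments from a point at distance `ρ` from the lateral boundary stay in `{u > 0}`: along such a
segment `u` keeps decreasing once it is nonpositive. -/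
lemma torsionFn_pos_segment (hf : StripBounds n f M K) (hp : SmallParam d n M K ε L ρ)
    {x₀ x₁ : EuclideanSpace ℝ (Fin d)} (hx₀ : ‖crossProj hd x₀‖ ≤ 1 - ρ) (hs₀ : x₀ ∈ slab hd)
    (hu₀ : 0 < torsionFn hd f ε x₀) (hs₁ : x₁ ∈ slab hd) (hu₁ : 0 < torsionFn hd f ε x₁)
    {t : ℝ} (ht : t ∈ Icc (0 : ℝ) 1) : 0 < torsionFn hd f ε (x₀ + t • (x₁ - x₀)) := by
  by_contra! hneg
  have hL₀ := abs_lt_of_torsionFn_nonneg hd hf hp (le_of_lt hs₀) hu₀.le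
  have hL₁ := abs_lt_of_torsionFn_nonneg hd hf hp (le_of_lt hs₁) hu₁.le
  have hφ := hasDerivAt_torsionFn_line hd f ε x₀ (x₁ - x₀)
  have ht0 : 0 < t := by
    refine ht.1.lt_of_ne fun h => ?_
    rw [← h, zero_smul, add_zero] at hneg
    exact hneg.not_gt hu₀
  have key := image_le_of_deriv_right_lt_deriv_boundary
    (f := fun s : ℝ => torsionFn hd f ε (x₀ + s • (x₁ - x₀))) (a := t) (b := 1)
    (fun s _ => (hφ s).continuousAt.continuousWithinAt) (fun s _ => (hφ s).hasDerivWithinAt)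
    (B := fun _ => 0) (B' := fun _ => 0) hneg (fun s => hasDerivAt_const _ _) ?_
    (right_mem_Icc.2 ht.2)
  · simp only [one_smul, add_sub_cancel] at key
    exact key.not_gt hu₁
  · intro s hs hs'
    have hs0 : 0 < s := ht0.trans_le hs.1
    have hsI : s ∈ Icc (0 : ℝ) 1 := ⟨hs0.le, hs.2.le⟩
    have hcoord : (x₀ + s • (x₁ - x₀)) (i₁ hd) = (1 - s) * x₀ (i₁ hd) + s * x₁ (i₁ hd) := by
      simp; ring
    have hLs : |(x₀ + s • (x₁ - x₀)) (i₁ hd)| ≤ L := by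
      rw [abs_lt] at hL₀ hL₁
      rw [hcoord, abs_le]
      have := hsI.2
      constructor <;> nlinarith
    have h := dTorsionFn_sub_neg hd hf hp hx₀ hu₀
      ((convex_slab hd).add_smul_sub_mem hs₀ hs₁ hsI) hLs hs'.le
    rw [add_sub_cancel_left, map_smul, smul_eq_mul] at h
    exact neg_of_mul_neg_right h hs0.le

lemma torsionFn_axisPt_pos (hf : StripBounds n f M K) (hp : SmallParam d n M K ε L ρ) {s : ℝ}
    (hs : |s| ≤ M) : 0 < torsionFn hd f ε (axisPt hd s) := by
  have h := torsionFn_ge hd hf hp.eps_pos.le (x := axisPt hd s) (by simp) (by simpa using hs)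
  rw [crossProj_axisPt, norm_zero] at h
  have := hp.eps_mul_K
  have := crossCoeff_pos hd
  linarith

lemma axisPt_zero : axisPt hd 0 = 0 := by
  rw [axisPt_eq_smul, zero_smul]

/-- The positivity set of `torsionFn` within the slab. -/
def posSet (f : ℝ[X]) (ε : ℝ) : Set (EuclideanSpace ℝ (Fin d)) :=
  {x | 0 < torsionFn hd f ε x} ∩ slab hd

lemma zero_mem_posSet (hf : StripBounds n f M K) (hp : SmallParam d n M K ε L ρ) :
    0 ∈ posSet hd f ε := by
  refine ⟨?_, ?_⟩
  · have := torsionFn_axisPt_pos hd hf hp (s := 0) (by simpa using hf.M_pos.le)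
    rwa [axisPt_zero] at this
  · simp [slab]

lemma starConvex_posSet (hf : StripBounds n f M K) (hp : SmallParam d n M K ε L ρ)
    {x₀ : EuclideanSpace ℝ (Fin d)} (hx₀ : x₀ ∈ posSet hd f ε)
    (hρ : ‖crossProj hd x₀‖ ≤ 1 - ρ) : StarConvex ℝ x₀ (posSet hd f ε) := by
  rw [starConvex_iff_segment_subset]
  intro y hy z hz
  rw [segment_eq_image'] at hz
  obtain ⟨t, ht, rfl⟩ := hz
  exact ⟨torsionFn_pos_segment hd hf hp hρ hx₀.2 hx₀.1 hy.2 hy.1 ht,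
    (convex_slab hd).add_smul_sub_mem hx₀.2 hy.2 ht⟩

lemma starConvex_zero_posSet (hf : StripBounds n f M K) (hp : SmallParam d n M K ε L ρ) :
    StarConvex ℝ 0 (posSet hd f ε) :=
  starConvex_posSet hd hf hp (zero_mem_posSet hd hf hp) (by simpa using hp.rho_le)

/-- The component of `0` in `{u > 0}` is the part of `{u > 0}` in the slab: that part is
star-shaped, and `u < 0` on the boundary of the slab. -/
lemma connectedComponentIn_eq_posSet (hf : StripBounds n f M K)
    (hp : SmallParam d n M K ε L ρ) :
    connectedComponentIn {x | 0 < torsionFn hd f ε x} 0 = posSet hd f ε := by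
  have h0 := zero_mem_posSet hd hf hp
  refine Subset.antisymm (fun x hx => ⟨connectedComponentIn_subset _ _ hx, ?_⟩) ?_
  · by_contra hxs
    have hxs' : 2 ≤ ‖crossProj hd x‖ ^ 2 := not_lt.1 hxs
    have hpre := isPreconnected_connectedComponentIn (x := (0 : EuclideanSpace ℝ (Fin d)))
      (F := {x | 0 < torsionFn hd f ε x})
    obtain ⟨y, hy, hy2⟩ := hpre.intermediate_value (mem_connectedComponentIn h0.1) hx
      (f := fun y => ‖crossProj hd y‖ ^ 2)
      (((crossProj hd).continuous.norm.pow 2).continuousOn)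
      (show (2 : ℝ) ∈ _ from ⟨by simp, hxs'⟩)
    have hy0 : y ∈ {x | 0 < torsionFn hd f ε x} := connectedComponentIn_subset _ _ hy
    exact (torsionFn_neg_of_sq_eq_two hd hf hp hy2).not_gt hy0
  · exact ((starConvex_zero_posSet hd hf hp).isPathConnected
      h0).isConnected.isPreconnected.subset_connectedComponentIn h0 inter_subset_left

lemma isOpen_posSet (f : ℝ[X]) (ε : ℝ) : IsOpen (posSet hd f ε) :=
  (isOpen_lt continuous_const (continuous_torsionFn hd f ε)).inter (isOpen_slab hd)

lemma abs_lt_of_mem_posSet (hf : StripBounds n f M K) (hp : SmallParam d n M K ε L ρ)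
    {x : EuclideanSpace ℝ (Fin d)} (hx : x ∈ posSet hd f ε) : |x (i₁ hd)| < L :=
  abs_lt_of_torsionFn_nonneg hd hf hp (le_of_lt hx.2) (le_of_lt hx.1)

lemma norm_crossProj_le_two {x : EuclideanSpace ℝ (Fin d)} (hx : x ∈ slab hd) :
    ‖crossProj hd x‖ ≤ 2 := by
  have : ‖crossProj hd x‖ ^ 2 < 2 := hx
  nlinarith [norm_nonneg (crossProj hd x)]

lemma isBounded_posSet (hf : StripBounds n f M K) (hp : SmallParam d n M K ε L ρ) :
    Bornology.IsBounded (posSet hd f ε) := by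
  refine (Metric.isBounded_closedBall (x := (0 : EuclideanSpace ℝ (Fin d)))
    (r := L + 2)).subset fun x hx => ?_
  rw [mem_closedBall_zero_iff]
  exact (norm_le_abs_add_norm_crossProj hd x).trans
    (add_le_add (abs_lt_of_mem_posSet hd hf hp hx).le (norm_crossProj_le_two hd hx.2))

lemma frontier_posSet (hf : StripBounds n f M K) (hp : SmallParam d n M K ε L ρ)
    {x : EuclideanSpace ℝ (Fin d)} (hx : x ∈ frontier (posSet hd f ε)) :
    torsionFn hd f ε x = 0 ∧ x ∈ slab hd ∧ |x (i₁ hd)| < L := by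
  rw [(isOpen_posSet hd f ε).frontier_eq] at hx
  have hcl : x ∈ {x | 0 ≤ torsionFn hd f ε x} ∩ {x | ‖crossProj hd x‖ ^ 2 ≤ 2} := by
    refine closure_minimal ?_ ?_ hx.1
    · exact fun y hy => ⟨le_of_lt (show 0 < torsionFn hd f ε y from hy.1),
        le_of_lt (show ‖crossProj hd y‖ ^ 2 < 2 from hy.2)⟩
    · exact (isClosed_le continuous_const (continuous_torsionFn hd f ε)).inter
        (isClosed_le ((crossProj hd).continuous.norm.pow 2) continuous_const)
  have hslab : x ∈ slab hd := lt_of_le_of_ne hcl.2 fun h =>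
    (torsionFn_neg_of_sq_eq_two hd hf hp h).not_ge hcl.1
  refine ⟨le_antisymm (not_lt.1 fun h => hx.2 ⟨h, hslab⟩) hcl.1, hslab,
    abs_lt_of_torsionFn_nonneg hd hf hp hcl.2 hcl.1⟩

lemma isSmoothBoundedDomain_posSet (hf : StripBounds n f M K) (hp : SmallParam d n M K ε L ρ) :
    IsSmoothBoundedDomain (posSet hd f ε) where
  isOpen := isOpen_posSet hd f ε
  isConnected := ((starConvex_zero_posSet hd hf hp).isPathConnected
    (zero_mem_posSet hd hf hp)).isConnected
  isBounded := isBounded_posSet hd hf hp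
  smooth_boundary p hfr := by
    obtain ⟨hu, hs, hL⟩ := frontier_posSet hd hf hp hfr
    have hcont : Continuous (fderiv ℝ (torsionFn hd f ε)) :=
      (contDiff_torsionFn hd f ε (m := 1)).continuous_fderiv one_ne_zero
    refine ⟨slab hd ∩ {x | fderiv ℝ (torsionFn hd f ε) x ≠ 0},
      (isOpen_slab hd).inter (isOpen_ne_fun hcont continuous_const), ⟨hs, fun h => ?_⟩,
      torsionFn hd f ε, (contDiff_torsionFn hd f ε).contDiffOn, fun x hx => hx.2, ?_⟩
    · have hneg := dTorsionFn_sub_neg hd hf hp (x₀ := 0) (by simpa using hp.rho_le)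
        (zero_mem_posSet hd hf hp).1 hs hL.le hu.le
      rw [← fderiv_torsionFn, h] at hneg
      simp at hneg
    · ext x
      constructor
      · exact fun hx => ⟨hx.2, hx.1.1⟩
      · exact fun hx => ⟨⟨hx.2, hx.1.1⟩, hx.1⟩

lemma isTorsionSolution_torsionFn (hf : StripBounds n f M K) (hp : SmallParam d n M K ε L ρ) :
    IsTorsionSolution (posSet hd f ε) (torsionFn hd f ε) where
  contDiffOn := (contDiff_torsionFn hd f ε).contDiffOn
  continuousOn := (continuous_torsionFn hd f ε).continuousOn
  equation x _ := by rw [laplacian_torsionFn, neg_neg]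
  boundary _ hx := (frontier_posSet hd hf hp hx).1

end

/-! ### Shrinking to the axis -/

section

variable {d : ℕ} (hd : 2 ≤ d) {n : ℕ} {f : ℝ[X]} {M K ε L ρ : ℝ}

lemma dTorsionFn_axisPt_one (f : ℝ[X]) (ε : ℝ) (x : EuclideanSpace ℝ (Fin d)) :
    dTorsionFn hd f ε x (axisPt hd 1) = ε * (aeval (planeMap hd x) f.derivative).re := by
  rw [dTorsionFn_apply, crossProj_axisPt, planeMap_axisPt]
  simp

lemma dTorsionFn_crossProj_le (hf : StripBounds n f M K) (hp : SmallParam d n M K ε L ρ)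
    {x : EuclideanSpace ℝ (Fin d)} (hx : x ∈ slab hd) (hs : |x (i₁ hd)| ≤ M) :
    dTorsionFn hd f ε x (crossProj hd x) ≤ -(crossCoeff d * ‖crossProj hd x‖ ^ 2) := by
  rw [dTorsionFn_apply, crossProj_crossProj, planeMap_crossProj, real_inner_self_eq_norm_sq]
  have h1 := hf.abs_im_derivative_le (planeMap hd x)
    (by rw [planeMap_im]; exact abs_i₂_le_two hd (le_of_lt hx)) (by rwa [planeMap_re])
  rw [planeMap_im] at h1
  set g := aeval (planeMap hd x) f.derivative
  set t := x (i₂ hd)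
  have h2 : (g * (t * Complex.I)).re = -(g.im * t) := by simp
  have h3 : -(g.im * t) ≤ K * ‖crossProj hd x‖ ^ 2 := by
    refine (neg_le_abs _).trans ?_
    rw [abs_mul, sq, ← mul_assoc]
    have h4 := abs_i₂_le hd x
    have := hf.K_pos
    exact mul_le_mul (h1.trans (by gcongr)) h4 (abs_nonneg _) (by positivity)
  rw [h2]
  have h5 := mul_le_mul_of_nonneg_left h3 hp.eps_pos.le
  have h6 := mul_le_mul_of_nonneg_right hp.eps_mul_K.le (sq_nonneg ‖crossProj hd x‖)
  have h7 : 0 ≤ crossCoeff d * ‖crossProj hd x‖ ^ 2 :=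
    mul_nonneg (crossCoeff_pos hd).le (sq_nonneg _)
  linarith

/-- In the middle part of the slab, `u` strictly decreases along segments leaving the axis
orthogonally. -/
lemma strictAntiOn_torsionFn (hf : StripBounds n f M K) (hp : SmallParam d n M K ε L ρ)
    {x : EuclideanSpace ℝ (Fin d)} (hx : x ∈ slab hd) (hs : |x (i₁ hd)| ≤ M)
    (h0 : crossProj hd x ≠ 0) :
    StrictAntiOn (fun τ : ℝ => torsionFn hd f ε (axisPt hd (x (i₁ hd)) + τ • crossProj hd x))
      (Icc 0 1) := by
  have hφ := hasDerivAt_torsionFn_line hd f ε (axisPt hd (x (i₁ hd))) (crossProj hd x)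
  refine strictAntiOn_of_deriv_neg (convex_Icc _ _)
    (fun t _ => (hφ t).continuousAt.continuousWithinAt) fun t ht => ?_
  rw [interior_Icc] at ht
  rw [(hφ t).deriv]
  set y := axisPt hd (x (i₁ hd)) + t • crossProj hd x with hy
  have hP : crossProj hd y = t • crossProj hd x := by simp [hy]
  have hys : y ∈ slab hd := by
    have hx' : ‖crossProj hd x‖ ^ 2 < 2 := hx
    show ‖crossProj hd y‖ ^ 2 < 2
    rw [hP, norm_smul, Real.norm_of_nonneg ht.1.le, mul_pow]
    have : t ^ 2 ≤ 1 := by nlinarith [ht.1, ht.2]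
    nlinarith [sq_nonneg ‖crossProj hd x‖]
  have h := dTorsionFn_crossProj_le hd hf hp hys (by simpa [hy] using hs)
  rw [hP, map_smul, smul_eq_mul, norm_smul, Real.norm_of_nonneg ht.1.le] at h
  have h1 : 0 < crossCoeff d * (t * ‖crossProj hd x‖) ^ 2 := by
    have := crossCoeff_pos hd
    have := norm_pos_iff.2 h0
    have := ht.1
    positivity
  exact neg_of_mul_neg_right (h.trans_lt (neg_neg_of_pos h1)) ht.1.le

lemma torsionFn_le_shrink (hf : StripBounds n f M K) (hp : SmallParam d n M K ε L ρ)
    {x : EuclideanSpace ℝ (Fin d)} (hx : x ∈ slab hd) (hs : |x (i₁ hd)| ≤ M) {τ : ℝ}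
    (hτ : τ ∈ Icc (0 : ℝ) 1) :
    torsionFn hd f ε x ≤ torsionFn hd f ε (axisPt hd (x (i₁ hd)) + τ • crossProj hd x) := by
  nth_rewrite 1 [← axisPt_add_crossProj hd x]
  by_cases h0 : crossProj hd x = 0
  · simp [h0]
  · have h := (strictAntiOn_torsionFn hd hf hp hx hs h0).antitoneOn hτ
      (right_mem_Icc.2 zero_le_one) hτ.2
    simpa only [one_smul] using h

lemma torsionFn_le_axisPt (hf : StripBounds n f M K) (hp : SmallParam d n M K ε L ρ)
    {x : EuclideanSpace ℝ (Fin d)} (hx : x ∈ slab hd) (hs : |x (i₁ hd)| ≤ M) :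
    torsionFn hd f ε x ≤ crossCoeff d + ε * f.eval (x (i₁ hd)) := by
  have h := torsionFn_le_shrink hd hf hp hx hs (τ := 0) ⟨le_rfl, zero_le_one⟩
  rwa [zero_smul, add_zero, torsionFn_axisPt] at h

lemma StripBounds.abs_lt_of_eval_pos (hf : StripBounds n f M K) {s : ℝ} (hs : 0 < f.eval s) :
    |s| < M := by
  by_contra! h
  have := hf.re_le s (by simp) (by simpa using h)
  rw [aeval_ofReal_re, Complex.ofReal_re] at this
  have := (even_two_mul n).pow_nonneg s
  linarith

lemma StripBounds.abs_lt_of_eval_derivative (hf : StripBounds n f M K) {s : ℝ}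
    (hs : f.derivative.eval s = 0) : |s| < M := by
  by_contra! h
  have := hf.re_mul_derivative_neg s (by simp) (by simpa using h)
  rw [aeval_ofReal_re, hs, mul_zero] at this
  exact this.false

lemma abs_lt_of_crossCoeff_lt (hf : StripBounds n f M K) (hp : SmallParam d n M K ε L ρ)
    {x : EuclideanSpace ℝ (Fin d)} (hx : x ∈ slab hd) (hu : crossCoeff d < torsionFn hd f ε x) :
    |x (i₁ hd)| < M := by
  by_contra! h
  have h1 := hf.re_le (planeMap hd x)
    (by rw [planeMap_im]; exact abs_i₂_le_two hd (le_of_lt hx)) (by rwa [planeMap_re])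
  have h2 : 0 ≤ (planeMap hd x).re ^ (2 * n) := (even_two_mul n).pow_nonneg _
  have h3 : ε * (aeval (planeMap hd x) f).re ≤ 0 :=
    mul_nonpos_of_nonneg_of_nonpos hp.eps_pos.le (by linarith)
  have h4 : 0 ≤ crossCoeff d * ‖crossProj hd x‖ ^ 2 :=
    mul_nonneg (crossCoeff_pos hd).le (sq_nonneg _)
  unfold torsionFn at hu
  linarith

lemma eval_pos_of_crossCoeff_lt (hf : StripBounds n f M K) (hp : SmallParam d n M K ε L ρ)
    {x : EuclideanSpace ℝ (Fin d)} (hx : x ∈ slab hd) (hu : crossCoeff d < torsionFn hd f ε x) :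
    0 < f.eval (x (i₁ hd)) := by
  have h := torsionFn_le_axisPt hd hf hp hx (abs_lt_of_crossCoeff_lt hd hf hp hx hu).le
  exact pos_of_mul_pos_right (by linarith) hp.eps_pos.le

lemma axisPt_mem_posSet (hf : StripBounds n f M K) (hp : SmallParam d n M K ε L ρ) {s : ℝ}
    (hs : |s| ≤ M) : axisPt hd s ∈ posSet hd f ε :=
  ⟨torsionFn_axisPt_pos hd hf hp hs, by simp [slab]⟩

lemma axisPt_injective : Function.Injective (axisPt hd) := fun s t h => by
  simpa using congrArg (fun x : EuclideanSpace ℝ (Fin d) => x (i₁ hd)) h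

/-! ### Components of the superlevel set -/

/-- The part of `{x ∈ Ω : u(x) > 1 / (2 (d - 1))}` over the `j`-th interval on which the polynomial
is positive. -/
def peakSet (f : ℝ[X]) (ε : ℝ) (r : ℕ → ℝ) (j : ℕ) : Set (EuclideanSpace ℝ (Fin d)) :=
  {x ∈ posSet hd f ε | crossCoeff d < torsionFn hd f ε x ∧
    x (i₁ hd) ∈ Ioo (r (2 * j)) (r (2 * j + 1))}

lemma isPreconnected_peakSet (hf : StripBounds n f M K) (hp : SmallParam d n M K ε L ρ)
    {r : ℕ → ℝ} {j : ℕ} (hpos : ∀ s ∈ Ioo (r (2 * j)) (r (2 * j + 1)), 0 < f.eval s) :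
    IsPreconnected (peakSet hd f ε r j) := by
  have haxis : ∀ s ∈ Ioo (r (2 * j)) (r (2 * j + 1)), axisPt hd s ∈ peakSet hd f ε r j := by
    intro s hs
    have hs0 := hpos s hs
    refine ⟨axisPt_mem_posSet hd hf hp (hf.abs_lt_of_eval_pos hs0).le, ?_, by simpa using hs⟩
    rw [torsionFn_axisPt]
    have := mul_pos hp.eps_pos hs0
    linarith
  rcases (peakSet hd f ε r j).eq_empty_or_nonempty with he | ⟨x₀, hx₀⟩
  · rw [he]; exact isPreconnected_empty
  have hI : IsPreconnected (axisPt hd '' Ioo (r (2 * j)) (r (2 * j + 1))) :=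
    isPreconnected_Ioo.image _ (continuous_axisPt hd).continuousOn
  refine isPreconnected_of_forall (axisPt hd (x₀ (i₁ hd))) fun y hy => ?_
  have hyM := abs_lt_of_crossCoeff_lt hd hf hp hy.1.2 hy.2.1
  refine ⟨segment ℝ (axisPt hd (y (i₁ hd))) y ∪ axisPt hd '' Ioo (r (2 * j)) (r (2 * j + 1)),
    union_subset ?_ ?_, Or.inr ⟨_, hx₀.2.2, rfl⟩, Or.inl (right_mem_segment _ _ _),
    (convex_segment _ _).isPreconnected.union (axisPt hd (y (i₁ hd))) (left_mem_segment _ _ _)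
      ⟨_, hy.2.2, rfl⟩ hI⟩
  · intro z hz
    rw [segment_eq_image'] at hz
    obtain ⟨τ, hτ, rfl⟩ := hz
    have hsub : y - axisPt hd (y (i₁ hd)) = crossProj hd y := by
      rw [sub_eq_iff_eq_add', axisPt_add_crossProj]
    have hslab := (convex_slab hd).add_smul_sub_mem
      (axisPt_mem_posSet hd hf hp (ε := ε) hyM.le).2 hy.1.2 hτ
    simp only [hsub] at hslab ⊢
    have hu := torsionFn_le_shrink hd hf hp hy.1.2 hyM.le hτ
    exact ⟨⟨lt_of_lt_of_le hy.1.1 hu, hslab⟩, hy.2.1.trans_le hu, by simpa using hy.2.2⟩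
  · rintro _ ⟨s, hs, rfl⟩
    exact haxis s hs

end

section

variable {d : ℕ} (hd : 2 ≤ d) {n : ℕ} {r c : ℕ → ℝ} {M K ε L ρ : ℝ}

lemma eval_nodePoly_self {m k : ℕ} (hk : k < m) : (nodePoly m r).eval (r k) = 0 := by
  rw [eval_nodePoly, Finset.prod_eq_zero (Finset.mem_range.2 hk) (sub_self _), neg_zero]

lemma eval_pos_of_mem_gap (hr : StrictMono r) {j : ℕ} (hj : j < n) :
    ∀ s ∈ Ioo (r (2 * j)) (r (2 * j + 1)), 0 < (nodePoly (2 * n) r).eval s := by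
  intro s hs
  simpa using sign_nodePoly_gap hr (n := n) (k := 2 * j) (by omega) hs.1 hs.2

lemma IsCriticalSeq.mem_gap (hc : IsCriticalSeq n r c) {k : ℕ} (hk : k + 1 < 2 * n) :
    c k ∈ Ioo (r k) (r (k + 1)) := ⟨hc.lt k hk, hc.lt_succ k hk⟩

lemma IsCriticalSeq.eq_of_mem_gap (hr : StrictMono r) (hc : IsCriticalSeq n r c) {k l : ℕ}
    (hk : k + 1 < 2 * n) (h : c k ∈ Ioo (r l) (r (l + 1))) : k = l := by
  have h1 := hr.lt_iff_lt.1 ((hc.lt k hk).trans h.2)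
  have h2 := hr.lt_iff_lt.1 (h.1.trans (hc.lt_succ k hk))
  omega

lemma IsCriticalSeq.inj (hr : StrictMono r) (hc : IsCriticalSeq n r c) {k l : ℕ}
    (hk : k + 1 < 2 * n) (hl : l + 1 < 2 * n) (h : c k = c l) : k = l :=
  hc.eq_of_mem_gap hr hk (h ▸ hc.mem_gap hl)

lemma axisPt_mem_peakSet (hr : StrictMono r) (hc : IsCriticalSeq n r c)
    (hf : StripBounds n (nodePoly (2 * n) r) M K) (hp : SmallParam d n M K ε L ρ) {j : ℕ}
    (hj : j < n) : axisPt hd (c (2 * j)) ∈ peakSet hd (nodePoly (2 * n) r) ε r j := by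
  have hm := hc.mem_gap (k := 2 * j) (by omega)
  have hpos := eval_pos_of_mem_gap hr hj _ hm
  refine ⟨axisPt_mem_posSet hd hf hp (hf.abs_lt_of_eval_pos hpos).le, ?_, by simpa using hm⟩
  rw [torsionFn_axisPt]
  have := mul_pos hp.eps_pos hpos
  linarith

/-- The components of the superlevel set are the sets over the positivity intervals of the
polynomial: between two of them there is a node, over which `u ≤ 1 / (2 (d - 1))`. -/
lemma components_eq_range (hr : StrictMono r) (hc : IsCriticalSeq n r c)
    (hf : StripBounds n (nodePoly (2 * n) r) M K) (hp : SmallParam d n M K ε L ρ) :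
    components {x ∈ posSet hd (nodePoly (2 * n) r) ε |
        crossCoeff d < torsionFn hd (nodePoly (2 * n) r) ε x} =
      range fun j : Fin n => peakSet hd (nodePoly (2 * n) r) ε r j := by
  set f := nodePoly (2 * n) r
  set S := {x ∈ posSet hd f ε | crossCoeff d < torsionFn hd f ε x} with hS
  have key : ∀ j < n, ∀ x ∈ peakSet hd f ε r j,
      connectedComponentIn S x = peakSet hd f ε r j := by
    intro j hj x hx
    have hxS : x ∈ S := ⟨hx.1, hx.2.1⟩
    refine Subset.antisymm (fun y hy => ?_)
      ((isPreconnected_peakSet hd hf hp (eval_pos_of_mem_gap hr hj)).subset_connectedComponentIn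
        hx fun y hy => ⟨hy.1, hy.2.1⟩)
    have hyS := connectedComponentIn_subset _ _ hy
    have hcont : ContinuousOn (fun z : EuclideanSpace ℝ (Fin d) => z (i₁ hd))
      (connectedComponentIn S x) := (EuclideanSpace.proj (𝕜 := ℝ) (i₁ hd)).continuous.continuousOn
    have hnode : ∀ k < 2 * n, ∀ z ∈ connectedComponentIn S x, z (i₁ hd) ≠ r k := by
      intro k hk z hz h
      have hzS := connectedComponentIn_subset _ _ hz
      have hpos := eval_pos_of_crossCoeff_lt hd hf hp hzS.1.2 hzS.2
      rw [h, eval_nodePoly_self hk] at hpos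
      exact hpos.false
    refine ⟨hyS.1, hyS.2, ?_, ?_⟩
    · by_contra! h
      obtain ⟨z, hz, hz'⟩ := isPreconnected_connectedComponentIn.intermediate_value hy
        (mem_connectedComponentIn hxS) hcont ⟨h, hx.2.2.1.le⟩
      exact hnode _ (by omega) z hz hz'
    · by_contra! h
      obtain ⟨z, hz, hz'⟩ := isPreconnected_connectedComponentIn.intermediate_value
        (mem_connectedComponentIn hxS) hy hcont ⟨hx.2.2.2.le, h⟩
      exact hnode _ (by omega) z hz hz'
  ext T
  constructor
  · rintro ⟨x, hx, rfl⟩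
    obtain ⟨j, hj, h1, h2⟩ :=
      exists_gap_of_eval_pos hr (eval_pos_of_crossCoeff_lt hd hf hp hx.1.2 hx.2)
    exact ⟨⟨j, hj⟩, (key j hj x ⟨hx.1, hx.2, h1, h2⟩).symm⟩
  · rintro ⟨j, rfl⟩
    have hm := axisPt_mem_peakSet hd hr hc hf hp j.2
    exact ⟨_, ⟨hm.1, hm.2.1⟩, (key j j.2 _ hm).symm⟩

lemma ncard_components (hr : StrictMono r) (hc : IsCriticalSeq n r c)
    (hf : StripBounds n (nodePoly (2 * n) r) M K) (hp : SmallParam d n M K ε L ρ) :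
    (components {x ∈ posSet hd (nodePoly (2 * n) r) ε |
        crossCoeff d < torsionFn hd (nodePoly (2 * n) r) ε x}).ncard = n := by
  rw [components_eq_range hd hr hc hf hp, ncard_range_of_injective, Nat.card_fin]
  intro i j hij
  have h := axisPt_mem_peakSet hd hr hc hf hp i.2
  simp only at hij
  rw [hij] at h
  have := hc.eq_of_mem_gap hr (k := 2 * i) (l := 2 * j) (by omega) (by simpa using h.2.2)
  exact Fin.ext (by omega)

lemma isMaxOn_peakSet (hc : IsCriticalSeq n r c)
    (hf : StripBounds n (nodePoly (2 * n) r) M K) (hp : SmallParam d n M K ε L ρ) {j : ℕ}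
    (hj : j < n) : IsMaxOn (torsionFn hd (nodePoly (2 * n) r) ε)
      (peakSet hd (nodePoly (2 * n) r) ε r j) (axisPt hd (c (2 * j))) := by
  intro y hy
  have h1 := torsionFn_le_axisPt hd hf hp hy.1.2 (abs_lt_of_crossCoeff_lt hd hf hp hy.1.2 hy.2.1).le
  have h2 := hc.extremal (2 * j) (by omega) _ ⟨hy.2.2.1.le, hy.2.2.2.le⟩
  rw [(even_two_mul j).neg_one_pow, one_mul, one_mul] at h2
  rw [mem_ofPred_eq, torsionFn_axisPt]
  have := mul_le_mul_of_nonneg_left h2 hp.eps_pos.le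
  linarith

/-! ### Critical points -/

lemma dTorsionFn_axisPt (f : ℝ[X]) (s : ℝ) (h : EuclideanSpace ℝ (Fin d)) :
    dTorsionFn hd f ε (axisPt hd s) h = ε * (f.derivative.eval s * h (i₁ hd)) := by
  rw [dTorsionFn_apply, crossProj_axisPt, inner_zero_left, planeMap_axisPt, Complex.mul_re,
    aeval_ofReal_im, aeval_ofReal_re, planeMap_re]
  ring

/-- All critical points lie on the axis. -/
lemma dTorsionFn_eq_zero_iff (hc : IsCriticalSeq n r c)
    (hf : StripBounds n (nodePoly (2 * n) r) M K) (hp : SmallParam d n M K ε L ρ)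
    {x : EuclideanSpace ℝ (Fin d)} (hx : x ∈ slab hd) :
    dTorsionFn hd (nodePoly (2 * n) r) ε x = 0 ↔ ∃ k, k + 1 < 2 * n ∧ x = axisPt hd (c k) := by
  have hε := hp.eps_pos
  constructor
  · intro h0
    have him : |(planeMap hd x).im| ≤ 2 := by
      rw [planeMap_im]; exact abs_i₂_le_two hd (le_of_lt hx)
    have hs : |x (i₁ hd)| ≤ M := by
      by_contra! hs
      have h1 := hf.re_mul_derivative_neg (planeMap hd x) him (by rw [planeMap_re]; exact hs.le)
      have h2 := dTorsionFn_axisPt_one hd (nodePoly (2 * n) r) ε x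
      rw [h0, _root_.zero_apply, eq_comm, mul_eq_zero] at h2
      rw [h2.resolve_left hε.ne', mul_zero] at h1
      exact h1.false
    have hP : crossProj hd x = 0 := by
      have h1 := dTorsionFn_crossProj_le hd hf hp hx hs
      rw [h0, _root_.zero_apply] at h1
      have h2 : ‖crossProj hd x‖ ^ 2 ≤ 0 := by
        by_contra! h2
        have := mul_pos (crossCoeff_pos hd) h2
        linarith
      exact norm_eq_zero.1 (pow_eq_zero_iff (two_ne_zero) |>.1 (le_antisymm h2 (sq_nonneg _)))
    have hxa : axisPt hd (x (i₁ hd)) = x := by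
      have := axisPt_add_crossProj hd x
      rwa [hP, add_zero] at this
    have h1 := dTorsionFn_axisPt hd (ε := ε) (nodePoly (2 * n) r) (x (i₁ hd)) (axisPt hd 1)
    rw [hxa, h0, _root_.zero_apply, axisPt_i₁, mul_one, eq_comm, mul_eq_zero] at h1
    obtain ⟨k, hk, hk'⟩ := (hc.eval_derivative_eq_zero_iff _).1 (h1.resolve_left hε.ne')
    exact ⟨k, hk, by rw [← hk', hxa]⟩
  · rintro ⟨k, hk, rfl⟩
    ext h
    rw [dTorsionFn_axisPt, (hc.eval_derivative_eq_zero_iff _).2 ⟨k, hk, rfl⟩]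
    simp

lemma abs_criticalSeq_lt (hc : IsCriticalSeq n r c)
    (hf : StripBounds n (nodePoly (2 * n) r) M K) {k : ℕ} (hk : k + 1 < 2 * n) : |c k| < M :=
  hf.abs_lt_of_eval_derivative ((hc.eval_derivative_eq_zero_iff _).2 ⟨k, hk, rfl⟩)

lemma isLocalMax_axisPt (hc : IsCriticalSeq n r c)
    (hf : StripBounds n (nodePoly (2 * n) r) M K) (hp : SmallParam d n M K ε L ρ) {k : ℕ}
    (hk : k + 1 < 2 * n) (he : Even k) :
    IsLocalMax (torsionFn hd (nodePoly (2 * n) r) ε) (axisPt hd (c k)) := by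
  have hcont : Tendsto (fun z : EuclideanSpace ℝ (Fin d) => z (i₁ hd)) (𝓝 (axisPt hd (c k)))
      (𝓝 (c k)) := by
    have := (EuclideanSpace.proj (𝕜 := ℝ) (i₁ hd)).continuous.tendsto (axisPt hd (c k))
    simpa using this
  have hM := abs_lt.1 (abs_criticalSeq_lt hc hf hk)
  filter_upwards [hcont.eventually (Icc_mem_nhds (hc.lt k hk) (hc.lt_succ k hk)),
    hcont.eventually (Icc_mem_nhds hM.1 hM.2),
    (isOpen_slab hd).mem_nhds (axisPt_mem_posSet hd hf hp
      (abs_criticalSeq_lt hc hf hk).le).2] with y h1 h2 h3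
  have h4 := torsionFn_le_axisPt hd hf hp h3 (abs_le.2 h2)
  have h5 := hc.extremal k hk _ h1
  rw [he.neg_one_pow, one_mul, one_mul] at h5
  rw [torsionFn_axisPt]
  have := mul_le_mul_of_nonneg_left h5 hp.eps_pos.le
  linarith

lemma not_isLocalMax_axisPt (hc : IsCriticalSeq n r c) (hε : 0 < ε) {k : ℕ}
    (hk : k + 1 < 2 * n) (ho : Odd k) :
    ¬ IsLocalMax (torsionFn hd (nodePoly (2 * n) r) ε) (axisPt hd (c k)) := by
  intro h
  have h' : ∀ᶠ y in 𝓝 (axisPt hd (c k)), torsionFn hd (nodePoly (2 * n) r) ε y ≤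
    torsionFn hd (nodePoly (2 * n) r) ε (axisPt hd (c k)) := h
  -- the polynomial would have a maximum and a minimum, hence a vanishing second derivative
  have hconst : (fun s => (nodePoly (2 * n) r).eval s) =ᶠ[𝓝 (c k)]
      fun _ => (nodePoly (2 * n) r).eval (c k) := by
    filter_upwards [(continuous_axisPt hd).continuousAt.eventually h',
      Icc_mem_nhds (hc.lt k hk) (hc.lt_succ k hk)] with s h1 h2
    have h3 := hc.extremal k hk s h2
    rw [ho.neg_one_pow] at h3
    rw [torsionFn_axisPt, torsionFn_axisPt] at h1
    have h4 := le_of_mul_le_mul_left (by linarith) hε (b := (nodePoly (2 * n) r).eval s)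
      (c := (nodePoly (2 * n) r).eval (c k))
    linarith
  have h2 := hconst.deriv.deriv_eq
  have hd1 : deriv (fun s => (nodePoly (2 * n) r).eval s) =
      fun s => (nodePoly (2 * n) r).derivative.eval s := funext fun s => Polynomial.deriv _
  rw [hd1, Polynomial.deriv] at h2
  refine hc.nondegenerate k hk (h2.trans ?_)
  simp

lemma not_isLocalMin_axisPt {f : ℝ[X]} (hf : StripBounds n f M K)
    (hp : SmallParam d n M K ε L ρ) {s : ℝ} (hs : |s| ≤ M) :
    ¬ IsLocalMin (torsionFn hd f ε) (axisPt hd s) := by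
  intro h
  have h' : ∀ᶠ y in 𝓝 (axisPt hd s), torsionFn hd f ε (axisPt hd s) ≤ torsionFn hd f ε y := h
  set x := axisPt hd s + EuclideanSpace.single (i₂ hd) (1 : ℝ) with hx
  have hxP : crossProj hd x = EuclideanSpace.single (i₂ hd) 1 := by
    ext i
    rw [crossProj_apply, hx, PiLp.add_apply, axisPt]
    by_cases hi : i = i₁ hd
    · simp [hi, i₁_ne_i₂ hd]
    · simp [hi]
  have hx1 : x (i₁ hd) = s := by simp [hx, i₁_ne_i₂ hd]
  have hxs : x ∈ slab hd := by
    show ‖crossProj hd x‖ ^ 2 < 2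
    rw [hxP]
    simp
  have hanti := strictAntiOn_torsionFn hd hf hp hxs (hx1 ▸ hs) (by rw [hxP]; simp)
  rw [hx1] at hanti
  have hcont : Tendsto (fun τ : ℝ => axisPt hd s + τ • crossProj hd x) (𝓝[>] 0)
      (𝓝 (axisPt hd s)) := by
    have : Continuous fun τ : ℝ => axisPt hd s + τ • crossProj hd x := by fun_prop
    have := this.tendsto 0
    rw [zero_smul, add_zero] at this
    exact this.mono_left nhdsWithin_le_nhds
  obtain ⟨τ, hτ1, hτ2⟩ := ((hcont.eventually h').and
    (Ioo_mem_nhdsGT (zero_lt_one (α := ℝ)))).exists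
  have := hanti (left_mem_Icc.2 zero_le_one) ⟨hτ2.1.le, hτ2.2.le⟩ hτ2.1
  simp only [zero_smul, add_zero] at this
  exact this.not_ge hτ1

lemma isSaddlePoint_axisPt (hc : IsCriticalSeq n r c)
    (hf : StripBounds n (nodePoly (2 * n) r) M K) (hp : SmallParam d n M K ε L ρ) {k : ℕ}
    (hk : k + 1 < 2 * n) (ho : Odd k) :
    IsSaddlePoint (torsionFn hd (nodePoly (2 * n) r) ε) (axisPt hd (c k)) := by
  have hM := abs_criticalSeq_lt hc hf hk
  refine ⟨?_, not_isLocalMax_axisPt hd hc hp.eps_pos hk ho, not_isLocalMin_axisPt hd hf hp hM.le⟩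
  rw [fderiv_torsionFn]
  exact (dTorsionFn_eq_zero_iff hd hc hf hp (axisPt_mem_posSet hd hf hp hM.le).2).2 ⟨k, hk, rfl⟩

lemma ncard_isLocalMax (hr : StrictMono r) (hc : IsCriticalSeq n r c)
    (hf : StripBounds n (nodePoly (2 * n) r) M K) (hp : SmallParam d n M K ε L ρ) :
    {x ∈ posSet hd (nodePoly (2 * n) r) ε |
      IsLocalMax (torsionFn hd (nodePoly (2 * n) r) ε) x}.ncard = n := by
  have h : {x ∈ posSet hd (nodePoly (2 * n) r) ε |
      IsLocalMax (torsionFn hd (nodePoly (2 * n) r) ε) x} =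
      range fun j : Fin n => axisPt hd (c (2 * j)) := by
    ext x
    constructor
    · rintro ⟨hx, hmax⟩
      obtain ⟨k, hk, rfl⟩ := (dTorsionFn_eq_zero_iff hd hc hf hp hx.2).1
        ((fderiv_torsionFn hd _ _ _).symm.trans hmax.fderiv_eq_zero)
      rcases Nat.even_or_odd k with he | ho
      · obtain ⟨j, rfl⟩ := he.two_dvd
        exact ⟨⟨j, by omega⟩, rfl⟩
      · exact absurd hmax (not_isLocalMax_axisPt hd hc hp.eps_pos hk ho)
    · rintro ⟨j, rfl⟩
      have hk : 2 * (j : ℕ) + 1 < 2 * n := by omega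
      exact ⟨axisPt_mem_posSet hd hf hp (abs_criticalSeq_lt hc hf hk).le,
        isLocalMax_axisPt hd hc hf hp hk (even_two_mul _)⟩
  rw [h, ncard_range_of_injective, Nat.card_fin]
  intro i j hij
  have := hc.inj hr (by omega) (by omega) (axisPt_injective hd hij)
  exact Fin.ext (by omega)

lemma ncard_isSaddlePoint (hr : StrictMono r) (hc : IsCriticalSeq n r c)
    (hf : StripBounds n (nodePoly (2 * n) r) M K) (hp : SmallParam d n M K ε L ρ) :
    {x ∈ posSet hd (nodePoly (2 * n) r) ε |
      IsSaddlePoint (torsionFn hd (nodePoly (2 * n) r) ε) x}.ncard = n - 1 := by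
  have h : {x ∈ posSet hd (nodePoly (2 * n) r) ε |
      IsSaddlePoint (torsionFn hd (nodePoly (2 * n) r) ε) x} =
      range fun j : Fin (n - 1) => axisPt hd (c (2 * j + 1)) := by
    ext x
    constructor
    · rintro ⟨hx, hsad⟩
      obtain ⟨k, hk, rfl⟩ := (dTorsionFn_eq_zero_iff hd hc hf hp hx.2).1
        ((fderiv_torsionFn hd _ _ _).symm.trans hsad.1)
      rcases Nat.even_or_odd k with he | ⟨j, rfl⟩
      · exact absurd (isLocalMax_axisPt hd hc hf hp hk he) hsad.2.1
      · exact ⟨⟨j, by omega⟩, rfl⟩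
    · rintro ⟨j, rfl⟩
      have hk : 2 * (j : ℕ) + 1 + 1 < 2 * n := by omega
      exact ⟨axisPt_mem_posSet hd hf hp (abs_criticalSeq_lt hc hf hk).le,
        isSaddlePoint_axisPt hd hc hf hp hk ⟨j, rfl⟩⟩
  rw [h, ncard_range_of_injective, Nat.card_fin]
  intro i j hij
  have := hc.inj hr (by omega) (by omega) (axisPt_injective hd hij)
  exact Fin.ext (by omega)

lemma critical_point_nondegenerate (hc : IsCriticalSeq n r c)
    (hf : StripBounds n (nodePoly (2 * n) r) M K) (hp : SmallParam d n M K ε L ρ)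
    {x : EuclideanSpace ℝ (Fin d)} (hx : x ∈ slab hd)
    (h0 : fderiv ℝ (torsionFn hd (nodePoly (2 * n) r) ε) x = 0) :
    (hessian (torsionFn hd (nodePoly (2 * n) r) ε) x).det ≠ 0 ∧
      (IsLocalMax (torsionFn hd (nodePoly (2 * n) r) ε) x ∨
        IsSaddlePoint (torsionFn hd (nodePoly (2 * n) r) ε) x) := by
  rw [fderiv_torsionFn] at h0
  obtain ⟨k, hk, rfl⟩ := (dTorsionFn_eq_zero_iff hd hc hf hp hx).1 h0
  refine ⟨?_, ?_⟩
  · rw [hessian_axisPt, Matrix.det_diagonal, Finset.prod_ne_zero_iff]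
    intro i _
    have hA := crossCoeff_pos hd
    have hε := hp.eps_pos
    have hb := hf.norm_derivative2_le (c k : ℂ) (by simp)
    have hre := (Complex.abs_re_le_norm _).trans hb
    rw [aeval_ofReal_re, Complex.ofReal_re] at hre
    have hM := (abs_criticalSeq_lt hc hf hk).le.trans hp.M_le
    have hK := hf.K_pos
    set g := (nodePoly (2 * n) r).derivative.derivative.eval (c k) with hg
    have hle : ε * |g| ≤ crossCoeff d := by
      refine le_trans ?_ hp.eps_mul_hess
      gcongr
      exact hre.trans (by gcongr)
    have hle' : -crossCoeff d ≤ ε * g := by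
      have := neg_abs_le g
      nlinarith
    split_ifs
    · exact mul_ne_zero hε.ne' (hc.nondegenerate k hk)
    · linarith
    · linarith
  · rcases Nat.even_or_odd k with he | ho
    · exact Or.inl (isLocalMax_axisPt hd hc hf hp hk he)
    · exact Or.inr (isSaddlePoint_axisPt hd hc hf hp hk ho)

end

/-! ### Volumes of thin cylindrical shells -/

section

variable {d : ℕ} (hd : 2 ≤ d)

/-- The closed cylinder `[-L, L] × closedBall 0 R`. -/
def closedCyl (L R : ℝ) : Set (EuclideanSpace ℝ (Fin d)) :=
  {x | |x (i₁ hd)| ≤ L ∧ ‖crossProj hd x‖ ≤ R}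

lemma isClosed_closedCyl (L R : ℝ) : IsClosed (closedCyl hd L R) :=
  (isClosed_le (EuclideanSpace.proj (𝕜 := ℝ) (i₁ hd)).continuous.abs continuous_const).inter
    (isClosed_le (crossProj hd).continuous.norm continuous_const)

lemma volume_closedCyl_lt_top (L R : ℝ) : volume (closedCyl hd L R) < ⊤ := by
  refine (Metric.isBounded_closedBall (x := (0 : EuclideanSpace ℝ (Fin d)))
    (r := L + R)).subset (fun x hx => ?_) |>.measure_lt_top
  rw [mem_closedBall_zero_iff]
  exact (norm_le_abs_add_norm_crossProj hd x).trans (add_le_add hx.1 hx.2)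

/-- Cylinders scale under the linear map `diag (L, R, …, R)`. -/
lemma volume_closedCyl {L R : ℝ} (hL : 0 < L) (hR : 0 < R) :
    volume (closedCyl hd L R) =
      ENNReal.ofReal (L * R ^ (d - 1)) * volume (closedCyl hd 1 1) := by
  set w : Fin d → ℝ := fun i => if i = i₁ hd then L else R with hw
  set T := Matrix.toEuclideanLin (Matrix.diagonal w) with hT
  have hTx : ∀ x i, T x i = w i * x i := fun x i => by
    rw [hT, Matrix.ofLp_toLpLin, Matrix.toLin'_apply, Matrix.mulVec_diagonal]
  have hdet : LinearMap.det T = L * R ^ (d - 1) := by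
    rw [hT, Matrix.toEuclideanLin_eq_toLin_orthonormal, LinearMap.det_toLin, Matrix.det_diagonal,
      ← Finset.mul_prod_erase _ _ (Finset.mem_univ (i₁ hd)),
      Finset.prod_congr rfl (g := fun _ => R) fun i hi => if_neg (Finset.ne_of_mem_erase hi),
      Finset.prod_const, Finset.card_erase_of_mem (Finset.mem_univ _), Finset.card_univ,
      Fintype.card_fin]
    simp [hw]
  have h1 : ∀ x, T x (i₁ hd) = L * x (i₁ hd) := fun x => by rw [hTx]; simp [hw]
  have h2 : ∀ x, crossProj hd (T x) = R • crossProj hd x := fun x => by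
    ext i
    rw [PiLp.smul_apply, crossProj_apply, crossProj_apply, hTx, hw]
    by_cases hi : i = i₁ hd <;> simp [hi]
  have himg : closedCyl hd L R = T '' closedCyl hd 1 1 := by
    ext x
    constructor
    · intro hx
      set y := axisPt hd (L⁻¹ * x (i₁ hd)) + R⁻¹ • crossProj hd x with hy
      have hy1 : y (i₁ hd) = L⁻¹ * x (i₁ hd) := by simp [hy]
      have hy2 : crossProj hd y = R⁻¹ • crossProj hd x := by simp [hy]
      refine ⟨y, ⟨?_, ?_⟩, ?_⟩
      · rw [hy1, abs_mul, abs_inv, abs_of_pos hL, inv_mul_le_iff₀ hL, mul_one]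
        exact hx.1
      · rw [hy2, norm_smul, norm_inv, Real.norm_of_nonneg hR.le, inv_mul_le_iff₀ hR, mul_one]
        exact hx.2
      · rw [← axisPt_add_crossProj hd (T y), h1, h2, hy1, hy2, mul_inv_cancel_left₀ hL.ne',
          smul_inv_smul₀ hR.ne', axisPt_add_crossProj]
    · rintro ⟨y, hy, rfl⟩
      refine ⟨?_, ?_⟩
      · rw [h1, abs_mul, abs_of_pos hL]
        exact mul_le_of_le_one_right hL.le hy.1
      · rw [h2, norm_smul, Real.norm_of_nonneg hR.le]
        exact mul_le_of_le_one_right hR.le hy.2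
  rw [himg, Measure.addHaar_image_linearMap, hdet, abs_of_pos (by positivity)]

/-- The part of a thin cylindrical shell of thickness `2 ρ` with `|x₁| ≤ L`. -/
def shell (L ρ : ℝ) : Set (EuclideanSpace ℝ (Fin d)) :=
  {x | |x (i₁ hd)| ≤ L ∧ 1 - ρ < ‖crossProj hd x‖ ∧ ‖crossProj hd x‖ ≤ 1 + ρ}

lemma exists_pow_sub_pow_le (k : ℕ) : ∃ C : ℝ, ∀ ρ : ℝ, 0 ≤ ρ → ρ ≤ 1 →
    (1 + ρ) ^ k - (1 - ρ) ^ k ≤ C * ρ := by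
  induction k with
  | zero => exact ⟨0, fun ρ _ _ => by simp⟩
  | succ k ih =>
    obtain ⟨C, hC⟩ := ih
    refine ⟨2 * |C| + 2, fun ρ h0 h1 => ?_⟩
    have h2 : (1 - ρ) ^ k ≤ 1 := pow_le_one₀ (by linarith) (by linarith)
    have h3 : (1 + ρ) ^ k - (1 - ρ) ^ k ≤ |C| * ρ :=
      (hC ρ h0 h1).trans (mul_le_mul_of_nonneg_right (le_abs_self C) h0)
    have h4 : 0 ≤ |C| * ρ := by positivity
    calc (1 + ρ) ^ (k + 1) - (1 - ρ) ^ (k + 1)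
        = (1 + ρ) * ((1 + ρ) ^ k - (1 - ρ) ^ k) + 2 * ρ * (1 - ρ) ^ k := by ring
      _ ≤ (1 + ρ) * (|C| * ρ) + 2 * ρ * 1 := by gcongr
      _ ≤ 2 * (|C| * ρ) + 2 * ρ * 1 := by gcongr; linarith
      _ = _ := by ring

lemma exists_volume_shell_le : ∃ C : ℝ, ∀ L ρ : ℝ, 0 < L → 0 < ρ → ρ < 1 →
    volume (shell hd L ρ) ≤ ENNReal.ofReal (C * (L * ρ)) := by
  obtain ⟨C, hC⟩ := exists_pow_sub_pow_le (d - 1)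
  set V := (volume (closedCyl hd 1 1)).toReal with hV
  have hVtop : volume (closedCyl hd 1 1) = ENNReal.ofReal V :=
    (ENNReal.ofReal_toReal (volume_closedCyl_lt_top hd 1 1).ne).symm
  have hV0 : 0 ≤ V := ENNReal.toReal_nonneg
  refine ⟨C * V, fun L ρ hL hρ hρ1 => ?_⟩
  have hsub : closedCyl hd L (1 - ρ) ⊆ closedCyl hd L (1 + ρ) := fun x hx =>
    ⟨hx.1, hx.2.trans (by linarith)⟩
  have hshell : shell hd L ρ ⊆ closedCyl hd L (1 + ρ) \ closedCyl hd L (1 - ρ) := fun x hx =>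
    ⟨⟨hx.1, hx.2.2⟩, fun h => hx.2.1.not_ge h.2⟩
  refine (measure_mono hshell).trans ?_
  have h1 : 0 ≤ L * (1 - ρ) ^ (d - 1) := mul_nonneg hL.le (pow_nonneg (by linarith) _)
  rw [measure_sdiff hsub (isClosed_closedCyl hd _ _).measurableSet.nullMeasurableSet
    (volume_closedCyl_lt_top hd _ _).ne, volume_closedCyl hd hL (by linarith),
    volume_closedCyl hd hL (by linarith), hVtop,
    ← ENNReal.ofReal_mul (mul_nonneg hL.le (pow_nonneg (by linarith) _)), ← ENNReal.ofReal_mul h1,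
    ← ENNReal.ofReal_sub _ (mul_nonneg h1 hV0)]
  refine ENNReal.ofReal_le_ofReal ?_
  have h2 := mul_le_mul_of_nonneg_left (hC ρ hρ.le hρ1.le) (mul_nonneg hL.le hV0)
  linarith

end

section

variable {d : ℕ} (hd : 2 ≤ d) {n : ℕ} {f : ℝ[X]} {M K ε L ρ : ℝ}

lemma SmallParam.four_mul_le (hf : StripBounds n f M K) (hp : SmallParam d n M K ε L ρ) :
    4 * (ε * K) ≤ crossCoeff d * ρ := by
  have h1 := hp.eps_pos
  have h2 := hf.K_pos
  have h3 := hp.one_le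
  have h4 := hf.M_pos
  have : 0 < ε * K := by positivity
  rw [hp.rho_mul]
  nlinarith

lemma sq_norm_crossProj_lt (hf : StripBounds n f M K) (hε : 0 ≤ ε)
    {x : EuclideanSpace ℝ (Fin d)} (hx : x ∈ posSet hd f ε) :
    crossCoeff d * (‖crossProj hd x‖ ^ 2 - 1) < ε * K := by
  have h1 := torsionFn_le hd hf hε (le_of_lt hx.2)
  have h2 : 0 < torsionFn hd f ε x := hx.1
  linarith

/-- Only points near the lateral boundary can fail to see the whole domain. -/
lemma sdiff_starSet_subset_shell (hf : StripBounds n f M K)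
    (hp : SmallParam d n M K ε L ρ) :
    posSet hd f ε \ starSet (posSet hd f ε) ⊆ shell hd L ρ := by
  rintro x ⟨hx, hns⟩
  have hA := crossCoeff_pos hd
  have hε := hp.eps_pos
  have hεK : 0 < ε * K := mul_pos hε hf.K_pos
  have h4 := hp.four_mul_le hf
  have hρ : 0 < ρ := pos_of_mul_pos_right (by linarith) hA.le
  refine ⟨(abs_lt_of_mem_posSet hd hf hp hx).le, ?_, ?_⟩
  · by_contra! h
    exact hns ⟨hx, starConvex_posSet hd hf hp hx h⟩
  · have h1 := sq_norm_crossProj_lt hd hf hε.le hx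
    have h2 : ‖crossProj hd x‖ ^ 2 - 1 < ρ := lt_of_mul_lt_mul_left (by linarith) hA.le
    by_contra! h
    nlinarith

/-- Within a compact set, the domain and the unit cylinder differ only where
`|(x₂, …, x_d)|² = 1 + O(ε)`. -/
lemma exists_symmDiff_bound (hf : StripBounds n f M K) {Q : Set (EuclideanSpace ℝ (Fin d))}
    (hQ : IsCompact Q) :
    ∃ B : ℝ, 0 ≤ B ∧ ∀ ε : ℝ, 0 < ε →
      ∀ x ∈ symmDiff (posSet hd f ε ∩ Q) (cylinder hd 1 ∩ Q),
        x ∈ Q ∧ |‖crossProj hd x‖ - 1| ≤ B * ε := by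
  have hA := crossCoeff_pos hd
  obtain ⟨KQ, hKQ⟩ := hQ.exists_bound_of_continuousOn
    (f := fun x => aeval (planeMap hd x) f)
    (fun x _ => (hasFDerivAt_aeval_planeMap hd f x).continuousAt.continuousWithinAt)
  refine ⟨(K + |KQ|) / crossCoeff d, by have := hf.K_pos; positivity, ?_⟩
  intro ε hε x hx
  -- it suffices to bound `|(x₂, …, x_d)|² - 1`
  have hred : |‖crossProj hd x‖ ^ 2 - 1| ≤ (K + |KQ|) / crossCoeff d * ε →
      |‖crossProj hd x‖ - 1| ≤ (K + |KQ|) / crossCoeff d * ε := fun h => by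
    refine le_trans ?_ h
    have h1 : ‖crossProj hd x‖ ^ 2 - 1 = (‖crossProj hd x‖ - 1) * (‖crossProj hd x‖ + 1) := by ring
    have h2 := norm_nonneg (crossProj hd x)
    rw [h1, abs_mul, abs_of_nonneg (show 0 ≤ ‖crossProj hd x‖ + 1 by linarith)]
    exact le_mul_of_one_le_right (abs_nonneg _) (by linarith)
  have hK := hf.K_pos
  have hcyl : ∀ y, y ∈ cylinder hd 1 ↔ ‖crossProj hd y‖ ^ 2 < 1 := fun y => by
    rw [norm_crossProj_sq, cylinder, mem_ofPred_eq, one_pow]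
  have hkey : ∀ b : ℝ, 0 ≤ b → b ≤ ε * (K + |KQ|) → ∀ q : ℝ, crossCoeff d * |q| ≤ b →
      |q| ≤ (K + |KQ|) / crossCoeff d * ε := fun b _ hb q hq => by
    rw [div_mul_eq_mul_div, le_div_iff₀ hA]
    linarith
  have h0 := abs_nonneg KQ
  rcases hx with ⟨⟨hxΩ, hxQ⟩, hxF⟩ | ⟨⟨hxF, hxQ⟩, hxΩ⟩
  · refine ⟨hxQ, hred (hkey (ε * K) (by positivity) (by gcongr; linarith) _ ?_)⟩
    have h1 : 1 ≤ ‖crossProj hd x‖ ^ 2 := by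
      by_contra! h
      exact hxF ⟨(hcyl x).2 h, hxQ⟩
    rw [abs_of_nonneg (by linarith)]
    exact (sq_norm_crossProj_lt hd hf hε.le hxΩ).le
  · refine ⟨hxQ, hred (hkey (ε * |KQ|) (by positivity) (by gcongr; linarith) _ ?_)⟩
    rw [hcyl] at hxF
    have hu : torsionFn hd f ε x ≤ 0 := by
      by_contra! h
      exact hxΩ ⟨⟨h, show ‖crossProj hd x‖ ^ 2 < 2 by linarith⟩, hxQ⟩
    rw [abs_of_nonpos (by linarith)]
    have h1 := (Complex.abs_re_le_norm _).trans ((hKQ x hxQ).trans (le_abs_self KQ))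
    have h2 := mul_le_mul_of_nonneg_left (abs_le.1 h1).1 hε.le
    unfold torsionFn at hu
    linarith

lemma mem_frontier_cylinder {p : EuclideanSpace ℝ (Fin d)} (hp : ‖crossProj hd p‖ = 1) :
    p ∈ frontier (cylinder hd 1) := by
  have hcyl : cylinder hd 1 = {y | ‖crossProj hd y‖ < 1} := by
    ext y
    rw [cylinder, mem_ofPred_eq, one_pow, ← norm_crossProj_sq, sq_lt_one_iff₀ (norm_nonneg _)]
    rfl
  have ho : IsOpen (cylinder hd 1) := by
    rw [hcyl]
    exact isOpen_lt (crossProj hd).continuous.norm continuous_const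
  rw [ho.frontier_eq]
  refine ⟨?_, fun h => ?_⟩
  · have hcont : Continuous fun τ : ℝ => axisPt hd (p (i₁ hd)) + τ • crossProj hd p := by fun_prop
    have hlim := hcont.tendsto 1
    rw [one_smul, axisPt_add_crossProj] at hlim
    refine mem_closure_of_tendsto (hlim.mono_left (nhdsWithin_le_nhds (s := Iio 1))) ?_
    filter_upwards [Ioo_mem_nhdsLT (zero_lt_one (α := ℝ))] with τ hτ
    rw [hcyl]
    simp [norm_smul, hp, abs_of_pos hτ.1, hτ.2]
  · rw [hcyl] at h
    exact (ne_of_lt h) hp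

lemma mem_thickening_frontier {x : EuclideanSpace ℝ (Fin d)} {δ : ℝ}
    (h0 : crossProj hd x ≠ 0) (h : |‖crossProj hd x‖ - 1| < δ) :
    x ∈ Metric.thickening δ (frontier (cylinder hd 1)) := by
  rw [Metric.mem_thickening_iff]
  have hn : ‖crossProj hd x‖ ≠ 0 := norm_ne_zero_iff.2 h0
  refine ⟨axisPt hd (x (i₁ hd)) + ‖crossProj hd x‖⁻¹ • crossProj hd x,
    mem_frontier_cylinder hd ?_, ?_⟩
  · simp [norm_smul, hn]
  · nth_rewrite 1 [← axisPt_add_crossProj hd x]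
    rw [dist_add_left, dist_eq_norm]
    have : crossProj hd x - ‖crossProj hd x‖⁻¹ • crossProj hd x =
        (1 - ‖crossProj hd x‖⁻¹) • crossProj hd x := by rw [sub_smul, one_smul]
    rw [this, norm_smul, Real.norm_eq_abs, ← abs_of_nonneg (norm_nonneg (crossProj hd x)),
      ← abs_mul, abs_of_nonneg (norm_nonneg (crossProj hd x)), sub_mul, inv_mul_cancel₀ hn, one_mul]
    exact h

end

section

/-- The half-length bound `(1 / (d - 1)) ^ (1 / (2 n)) * ε ^ (-1 / (2 n))`. -/
noncomputable def halfLength (d n : ℕ) (ε : ℝ) : ℝ :=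
  (1 / ((d : ℝ) - 1)) ^ (1 / (2 * (n : ℝ))) * ε ^ (-1 / (2 * (n : ℝ)))

/-- The distance to the lateral boundary from which on all points see the whole domain. -/
noncomputable def lateralGap (d n : ℕ) (M K ε : ℝ) : ℝ :=
  4 * K * ε * (M + halfLength d n ε + 4) / crossCoeff d

variable {d n : ℕ} {M K : ℝ}

lemma halfLength_pow (hd : 2 ≤ d) (hn : 0 < n) {ε : ℝ} (hε : 0 < ε) :
    ε * halfLength d n ε ^ (2 * n) = 2 * crossCoeff d := by
  have hd' : (2 : ℝ) ≤ d := by exact_mod_cast hd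
  have h0 : 0 < 1 / ((d : ℝ) - 1) := by
    have : 0 < (d : ℝ) - 1 := by linarith
    positivity
  have hn' : (2 * (n : ℝ)) ≠ 0 := by positivity
  rw [halfLength, mul_pow, ← Real.rpow_natCast, ← Real.rpow_natCast, ← Real.rpow_mul h0.le,
    ← Real.rpow_mul hε.le, two_mul_crossCoeff hd]
  push_cast
  rw [div_mul_cancel₀ _ hn', div_mul_cancel₀ _ hn', Real.rpow_one, Real.rpow_neg_one]
  field_simp

lemma tendsto_halfLength (hd : 2 ≤ d) (hn : 0 < n) : Tendsto (halfLength d n) (𝓝[>] 0) atTop := by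
  have hd' : (2 : ℝ) ≤ d := by exact_mod_cast hd
  have h0 : 0 < 1 / ((d : ℝ) - 1) := by
    have : 0 < (d : ℝ) - 1 := by linarith
    positivity
  refine Tendsto.const_mul_atTop (Real.rpow_pos_of_pos h0 _) (tendsto_rpow_neg_nhdsGT_zero ?_)
  have : (0 : ℝ) < n := by exact_mod_cast hn
  exact div_neg_of_neg_of_pos (by norm_num) (by positivity)

/-- Since `n ≥ 2`, `ε L ^ 2 = O(L ^ (2 - 2 n))` tends to `0`. -/
lemma lateralGap_mul_halfLength_le (hd : 2 ≤ d) (hn : 2 ≤ n) (hM : 0 < M) (hK : 0 < K)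
    {ε : ℝ} (hε : 0 < ε) (hL : 1 ≤ halfLength d n ε) :
    halfLength d n ε * lateralGap d n M K ε ≤ 8 * K * (M + 5) / halfLength d n ε ^ 2 := by
  have hA := crossCoeff_pos hd
  have hpow := halfLength_pow hd (n := n) (by omega) hε
  unfold lateralGap
  set L := halfLength d n ε
  have hL0 : 0 < L := by linarith
  have h1 : ε * L ^ 4 ≤ 2 * crossCoeff d := by
    rw [← hpow]
    exact mul_le_mul_of_nonneg_left (pow_le_pow_right₀ hL (by omega)) hε.le
  have h2 : M + L + 4 ≤ (M + 5) * L := by nlinarith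
  rw [mul_div_assoc', div_le_div_iff₀ hA (by positivity)]
  calc L * (4 * K * ε * (M + L + 4)) * L ^ 2
      ≤ L * (4 * K * ε * ((M + 5) * L)) * L ^ 2 := by gcongr
    _ = 4 * K * (M + 5) * (ε * L ^ 4) := by ring
    _ ≤ 4 * K * (M + 5) * (2 * crossCoeff d) := by gcongr
    _ = _ := by ring

lemma tendsto_const_div_halfLength_sq (hd : 2 ≤ d) (hn : 0 < n) (c : ℝ) :
    Tendsto (fun ε => c / halfLength d n ε ^ 2) (𝓝[>] 0) (𝓝 0) :=
  ((tendsto_pow_atTop two_ne_zero).comp (tendsto_halfLength hd hn)).const_div_atTop c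

lemma eventually_smallParam (hd : 2 ≤ d) (hn : 2 ≤ n) (hM : 0 < M) (hK : 0 < K) :
    ∀ᶠ ε in 𝓝[>] (0 : ℝ), SmallParam d n M K ε (halfLength d n ε) (lateralGap d n M K ε) ∧
      lateralGap d n M K ε < 1 := by
  have hA := crossCoeff_pos hd
  have hlim := tendsto_halfLength hd (n := n) (by omega)
  have h1 : ∀ᶠ ε in 𝓝[>] (0 : ℝ), ε * K < crossCoeff d / 4 := by
    have : Tendsto (fun ε : ℝ => ε * K) (𝓝 0) (𝓝 (0 * K)) :=
      (continuous_id.mul continuous_const).tendsto 0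
    rw [zero_mul] at this
    exact (this.mono_left nhdsWithin_le_nhds).eventually_lt_const (by positivity)
  have h2 := (tendsto_const_div_halfLength_sq hd (n := n) (by omega)
    (K * 2 ^ (2 * n - 2) * (2 * crossCoeff d))).eventually_lt_const hA
  have h3 := (tendsto_const_div_halfLength_sq hd (n := n) (by omega)
    (8 * K * (M + 5))).eventually_lt_const one_pos
  filter_upwards [self_mem_nhdsWithin, hlim.eventually_ge_atTop (max M 1), h1, h2, h3]
    with ε hε hL h1 h2 h3
  have hε : 0 < ε := hε
  have hL1 := (le_max_right _ _).trans hL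
  have hpow := halfLength_pow hd (n := n) (by omega) hε
  have hgap := lateralGap_mul_halfLength_le hd hn hM hK hε hL1
  have hgap0 : 0 ≤ lateralGap d n M K ε := by
    unfold lateralGap
    positivity
  have hlt : lateralGap d n M K ε < 1 :=
    (le_mul_of_one_le_left hgap0 hL1).trans_lt (hgap.trans_lt h3)
  refine ⟨⟨hε, hL1, (le_max_left _ _).trans hL, hpow, h1, ?_, ?_, hlt.le⟩, hlt⟩
  · set L := halfLength d n ε
    have hL0 : 0 < L := by linarith
    refine le_trans ?_ h2.le
    rw [le_div_iff₀ (by positivity), ← hpow]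
    have : (1 + L) ^ (2 * n - 2) ≤ (2 * L) ^ (2 * n - 2) := by gcongr; linarith
    calc ε * (K * (1 + L) ^ (2 * n - 2)) * L ^ 2
        ≤ ε * (K * (2 * L) ^ (2 * n - 2)) * L ^ 2 := by gcongr
      _ = K * 2 ^ (2 * n - 2) * (ε * (L ^ (2 * n - 2) * L ^ 2)) := by rw [mul_pow]; ring
      _ = _ := by rw [← pow_add, Nat.sub_add_cancel (by omega)]
  · rw [lateralGap, mul_div_cancel₀ _ hA.ne']

end

/-! ### Limits as the parameter tends to zero -/

section

variable {d : ℕ} (hd : 2 ≤ d) {n : ℕ} {f : ℝ[X]} {M K : ℝ}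

/-- The points from which the domain is not star-shaped lie in a shell of volume `O(L ρ)`. -/
lemma tendsto_volume_sdiff_starSet (hn : 2 ≤ n) (hf : StripBounds n f M K) :
    Tendsto (fun ε => volume (posSet hd f ε \ starSet (posSet hd f ε))) (𝓝[>] 0) (𝓝 0) := by
  obtain ⟨C, hC⟩ := exists_volume_shell_le hd
  have hA := crossCoeff_pos hd
  have hlim : Tendsto (fun ε => ENNReal.ofReal (|C| * (8 * K * (M + 5) / halfLength d n ε ^ 2)))
      (𝓝[>] 0) (𝓝 0) := by
    have := (tendsto_const_div_halfLength_sq hd (n := n) (by omega) (8 * K * (M + 5))).const_mul |C|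
    rw [mul_zero] at this
    simpa using ENNReal.tendsto_ofReal this
  refine tendsto_of_tendsto_of_tendsto_of_le_of_le' tendsto_const_nhds hlim
    (Eventually.of_forall fun _ => zero_le) ?_
  filter_upwards [eventually_smallParam hd hn hf.M_pos hf.K_pos] with ε hε
  obtain ⟨hp, hlt⟩ := hε
  have hL0 : 0 < halfLength d n ε := zero_lt_one.trans_le hp.one_le
  have hρ : 0 < lateralGap d n M K ε := by
    have h1 := hp.four_mul_le hf
    have h2 : 0 < ε * K := mul_pos hp.eps_pos hf.K_pos
    exact pos_of_mul_pos_right (by linarith) hA.le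
  refine (measure_mono (sdiff_starSet_subset_shell hd hf hp)).trans
    ((hC _ _ hL0 hρ hlt).trans (ENNReal.ofReal_le_ofReal ?_))
  have h1 := lateralGap_mul_halfLength_le hd hn hf.M_pos hf.K_pos hp.eps_pos hp.one_le
  exact mul_le_mul (le_abs_self C) h1 (mul_pos hL0 hρ).le (abs_nonneg C)

lemma eventually_symmDiff_subset_thickening (hf : StripBounds n f M K)
    {Q : Set (EuclideanSpace ℝ (Fin d))} (hQ : IsCompact Q) {δ : ℝ} (hδ : 0 < δ) :
    ∀ᶠ ε in 𝓝[>] (0 : ℝ), symmDiff (posSet hd f ε ∩ Q) (cylinder hd 1 ∩ Q) ⊆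
      Metric.thickening δ (frontier (cylinder hd 1)) := by
  obtain ⟨B, hB, hb⟩ := exists_symmDiff_bound hd hf hQ
  have hlim : Tendsto (fun ε : ℝ => B * ε) (𝓝[>] 0) (𝓝 0) := by
    have : Tendsto (fun ε : ℝ => B * ε) (𝓝 0) (𝓝 (B * 0)) :=
      (continuous_const.mul continuous_id).tendsto 0
    rw [mul_zero] at this
    exact this.mono_left nhdsWithin_le_nhds
  filter_upwards [self_mem_nhdsWithin, hlim.eventually_lt_const hδ,
    hlim.eventually_lt_const one_pos] with ε hε h1 h2 x hx
  have h := (hb ε hε x hx).2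
  refine mem_thickening_frontier hd (fun h0 => ?_) (h.trans_lt h1)
  rw [h0] at h
  norm_num at h
  linarith

lemma tendsto_volume_symmDiff (hf : StripBounds n f M K)
    {Q : Set (EuclideanSpace ℝ (Fin d))} (hQ : IsCompact Q) :
    Tendsto (fun ε => volume (symmDiff (posSet hd f ε ∩ Q) (cylinder hd 1 ∩ Q)))
      (𝓝[>] 0) (𝓝 0) := by
  obtain ⟨B, hB, hb⟩ := exists_symmDiff_bound hd hf hQ
  obtain ⟨C, hC⟩ := exists_volume_shell_le hd
  obtain ⟨R, hR⟩ := hQ.isBounded.exists_norm_le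
  have hlin : ∀ b : ℝ, Tendsto (fun ε : ℝ => b * ε) (𝓝[>] 0) (𝓝 0) := fun b => by
    have : Tendsto (fun ε : ℝ => b * ε) (𝓝 0) (𝓝 (b * 0)) :=
      (continuous_const.mul continuous_id).tendsto 0
    rw [mul_zero] at this
    exact this.mono_left nhdsWithin_le_nhds
  have hlim : Tendsto (fun ε : ℝ => ENNReal.ofReal (C * ((|R| + 1) * ((B + 1) * ε))))
      (𝓝[>] 0) (𝓝 0) := by
    have := ENNReal.tendsto_ofReal (hlin (C * ((|R| + 1) * (B + 1))))
    rw [ENNReal.ofReal_zero] at this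
    refine this.congr fun ε => ?_
    congr 1
    ring
  refine tendsto_of_tendsto_of_tendsto_of_le_of_le' tendsto_const_nhds hlim
    (Eventually.of_forall fun _ => zero_le) ?_
  filter_upwards [self_mem_nhdsWithin, (hlin (B + 1)).eventually_lt_const one_pos] with ε hε h1
  have hε : 0 < ε := hε
  refine (measure_mono fun x hx => ?_).trans
    (hC (|R| + 1) ((B + 1) * ε) (by positivity) (by positivity) h1)
  obtain ⟨hxQ, hx1⟩ := hb ε hε x hx
  rw [abs_le] at hx1
  have hx2 := PiLp.norm_apply_le x (i₁ hd)
  rw [Real.norm_eq_abs] at hx2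
  exact ⟨by linarith [hR x hxQ, le_abs_self R], by linarith, by linarith⟩

end

end Torsion

theorem theorem2p2 (d : ℕ) (hd : 2 ≤ d) (n : ℕ) (hn : 2 ≤ n) (a : Fin n → ℝ)
    (ha_pos : ∀ i, 0 < a i) (ha_mono : StrictMono a) :
    (∃ ε₀ : ℝ, 0 < ε₀ ∧ ∃ C : ℝ, 0 < C ∧ ∃ c : ℝ, 0 < c ∧ ∀ ε : ℝ, 0 < ε → ε < ε₀ →
      Torsion.IsSmoothBoundedDomain (Torsion.Om hd a ε) ∧
      -- (i) unique solution, uniform bounds, localization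
      Torsion.IsTorsionSolution (Torsion.Om hd a ε) (Torsion.u hd a ε) ∧
      (∀ w : EuclideanSpace ℝ (Fin d) → ℝ, Torsion.IsTorsionSolution (Torsion.Om hd a ε) w →
        EqOn w (Torsion.u hd a ε) (closure (Torsion.Om hd a ε))) ∧
      (∀ l : ℕ, Torsion.cNorm l (Torsion.Om hd a ε) (Torsion.u hd a ε) ≤ ENNReal.ofReal C) ∧
      (∀ x ∈ Torsion.Om hd a ε,
        |x (Torsion.i₁ hd)| < (1 / ((d : ℝ) - 1)) ^ (1 / (2 * (n : ℝ))) * ε ^ (-1 / (2 * (n : ℝ))) ∧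
        x ∈ Torsion.cylinder hd (Real.sqrt 2)) ∧
      -- (ii) star-shaped with respect to the origin
      0 ∈ Torsion.starSet (Torsion.Om hd a ε) ∧
      -- (iii) components of the superlevel set
      (Torsion.components
        {x ∈ Torsion.Om hd a ε | 1 / (2 * ((d : ℝ) - 1)) < Torsion.u hd a ε x}).ncard = n ∧
      (∀ K ∈ Torsion.components
          {x ∈ Torsion.Om hd a ε | 1 / (2 * ((d : ℝ) - 1)) < Torsion.u hd a ε x},
        ∃ x ∈ K, IsMaxOn (Torsion.u hd a ε) K x ∧
          1 / (2 * ((d : ℝ) - 1)) + c * ε < Torsion.u hd a ε x) ∧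
      -- (iv) critical points
      {x ∈ Torsion.Om hd a ε | IsLocalMax (Torsion.u hd a ε) x}.ncard = n ∧
      {x ∈ Torsion.Om hd a ε | Torsion.IsSaddlePoint (Torsion.u hd a ε) x}.ncard = n - 1 ∧
      (∀ x ∈ Torsion.Om hd a ε, fderiv ℝ (Torsion.u hd a ε) x = 0 →
        (Torsion.hessian (Torsion.u hd a ε) x).det ≠ 0 ∧
        (IsLocalMax (Torsion.u hd a ε) x ∨ Torsion.IsSaddlePoint (Torsion.u hd a ε) x))) ∧
    -- (v) almost convexity
    Tendsto (fun ε : ℝ =>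
        volume (Torsion.Om hd a ε \ Torsion.starSet (Torsion.Om hd a ε))) (𝓝[>] 0) (𝓝 0) ∧
    -- (vi) local convergence to the unit cylinder
    (∀ Q : Set (EuclideanSpace ℝ (Fin d)), IsCompact Q →
      (∀ δ : ℝ, 0 < δ → ∀ᶠ ε in 𝓝[>] (0 : ℝ),
        symmDiff (Torsion.Om hd a ε ∩ Q) (Torsion.cylinder hd 1 ∩ Q) ⊆
          Metric.thickening δ (frontier (Torsion.cylinder hd 1))) ∧
      Tendsto (fun ε : ℝ =>
        volume (symmDiff (Torsion.Om hd a ε ∩ Q) (Torsion.cylinder hd 1 ∩ Q)))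
        (𝓝[>] 0) (𝓝 0)) := by
  obtain ⟨r, hr, hra⟩ := Torsion.exists_strictMono_nodes a ha_pos ha_mono
  obtain ⟨c, hc⟩ := Torsion.exists_critical_points hr (n := n) (by omega)
  obtain ⟨M, K, hf⟩ := Torsion.exists_stripBounds (n := n) (by omega)
    (Torsion.natDegree_nodePoly (2 * n) r) (Torsion.leadingCoeff_nodePoly (2 * n) r)
  have hu : ∀ ε, Torsion.u hd a ε = Torsion.torsionFn hd (Torsion.nodePoly (2 * n) r) ε :=
    fun ε => Torsion.u_eq_torsionFn hd ε hra
  have hsmall := Torsion.eventually_smallParam hd hn hf.M_pos hf.K_pos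
  have hOm : ∀ {ε L ρ}, Torsion.SmallParam d n M K ε L ρ →
      Torsion.Om hd a ε = Torsion.posSet hd (Torsion.nodePoly (2 * n) r) ε := fun {ε L ρ} hp => by
    rw [Torsion.Om, hu, Torsion.connectedComponentIn_eq_posSet hd hf hp]
  have hOmev : ∀ᶠ ε in 𝓝[>] (0 : ℝ),
      Torsion.Om hd a ε = Torsion.posSet hd (Torsion.nodePoly (2 * n) r) ε := by
    filter_upwards [hsmall] with ε hp using hOm hp.1
  refine ⟨?_, ?_, fun Q hQ => ⟨fun δ hδ => ?_, ?_⟩⟩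
  · obtain ⟨C, hC, hCb⟩ := Torsion.exists_cNorm_torsionFn_le hd (n := n) (by omega)
      (Torsion.natDegree_nodePoly (2 * n) r).le
    -- `κ` is smaller than all the peak values of the polynomial
    obtain ⟨κ, hκ, hκ0⟩ : ∃ κ : ℝ, (∀ j ∈ Finset.range n,
        κ < (Torsion.nodePoly (2 * n) r).eval (c (2 * j))) ∧ 0 < κ := by
      have h : ∀ᶠ κ in 𝓝[>] (0 : ℝ), ∀ j ∈ Finset.range n,
          κ < (Torsion.nodePoly (2 * n) r).eval (c (2 * j)) := by
        rw [Filter.eventually_all_finset]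
        intro j hj
        rw [Finset.mem_range] at hj
        filter_upwards [Ioo_mem_nhdsGT (Torsion.eval_pos_of_mem_gap hr hj _
          (hc.mem_gap (k := 2 * j) (by omega)))] with κ hκ using hκ.2
      exact (h.and self_mem_nhdsWithin).exists
    obtain ⟨ε₀, hε₀, hall⟩ := mem_nhdsGT_iff_exists_Ioo_subset.1 hsmall
    refine ⟨ε₀, hε₀, C, hC, κ, hκ0, fun ε hε hlt => ?_⟩
    obtain ⟨hp, -⟩ := hall ⟨hε, hlt⟩
    rw [hOm hp, hu]
    have hdom := Torsion.isSmoothBoundedDomain_posSet hd hf hp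
    have hsol := Torsion.isTorsionSolution_torsionFn hd hf hp
    refine ⟨hdom, hsol, fun w hw => hw.eqOn (by omega) hdom.isOpen hdom.isBounded hsol,
      hCb ε _ hε hp.one_le hp.eps_mul_pow _ fun x hx =>
        ⟨(Torsion.abs_lt_of_mem_posSet hd hf hp hx).le, Torsion.norm_crossProj_le_two hd hx.2⟩,
      fun x hx => ⟨Torsion.abs_lt_of_mem_posSet hd hf hp hx, ?_⟩,
      ⟨Torsion.zero_mem_posSet hd hf hp, Torsion.starConvex_zero_posSet hd hf hp⟩,
      Torsion.ncard_components hd hr hc hf hp, ?_, Torsion.ncard_isLocalMax hd hr hc hf hp,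
      Torsion.ncard_isSaddlePoint hd hr hc hf hp,
      fun x hx h0 => Torsion.critical_point_nondegenerate hd hc hf hp hx.2 h0⟩
    · rw [Torsion.cylinder, mem_ofPred_eq, Real.sq_sqrt (by norm_num), ← Torsion.norm_crossProj_sq]
      exact hx.2
    · intro T hT
      have hT' := (Torsion.components_eq_range hd hr hc hf hp).subset hT
      obtain ⟨j, rfl⟩ := hT'
      refine ⟨_, Torsion.axisPt_mem_peakSet hd hr hc hf hp j.2,
        Torsion.isMaxOn_peakSet hd hc hf hp j.2, ?_⟩
      rw [Torsion.torsionFn_axisPt, mul_comm κ]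
      exact add_lt_add_right (mul_lt_mul_of_pos_left (hκ j (Finset.mem_range.2 j.2)) hε) _
  · refine (Torsion.tendsto_volume_sdiff_starSet hd hn hf).congr' ?_
    filter_upwards [hOmev] with ε hε
    rw [hε]
  · filter_upwards [hOmev, Torsion.eventually_symmDiff_subset_thickening hd hf hQ hδ] with ε h1 h2
    rw [h1]
    exact h2
  · refine (Torsion.tendsto_volume_symmDiff hd hf hQ).congr' ?_
    filter_upwards [hOmev] with ε hε
    rw [hε]
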